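/- Let $\mathbf k$ be a field of characteristic $0$ and let $H=\mathbf k[s]$ be the Hopf algebra with $\Delta(s)=s\otimes 1+1\otimes s$; write $s^{(n)}=s^n/n!$ and $\otimes=\otimes_{\mathbf k}$. Regard $H^{\otimes 2}$ and $H^{\otimes 3}$ as right $H$-modules through $\Delta$ and $(\Delta\otimes 1)\Delta$. A Lie $H$-pseudoalgebra is an $H$-module $L$ with a $\mathbf k$-bilinear pseudobracket $[\cdot,\cdot]:L\times L\to H^{\otimes 2}\otimes_H L$ such that $[fa,gb]=(f\otimes g\otimes_H 1)[a,b]$ for $f,g\in H$, $[a,b]=-((12)\otimes_H1)[b,a]$ and $[[a,b],c]=[a,[b,c]]-((12)\otimes_H 1)[b,[a,c]]$ in $H^{\otimes3}\otimes_HL$; here, if $[b,c]=\sum_i F_i\otimes_H x_i$ and $[a,x_i]=\sum_j G_{ij}\otimes_H y_{ij}$, then $[a,[b,c]]=\sum_{i,j}(1\otimes F_i)(1\otimes\Delta)(G_{ij})\otimes_H y_{ij}$, and if $[a,b]=\sum_i F_i\otimes_H x_i$ and $[x_i,c]=\sum_j G_{ij}\otimes_H y_{ij}$, then $[[a,b],c]=\sum_{i,j}(F_i\otimes1)(\Delta\otimes1)(G_{ij})\otimes_H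 y_{ij}$. A Schrödinger–Virasoro Lie $H$-pseudoalgebra is a Lie $H$-pseudoalgebra $L$ that is a free $H$-module with a basis $e_0,e_1,e_2,e_3$ such that $$\begin{aligned}&[e_0,e_0]=\alpha\otimes_He_0,\quad [e_0,e_i]=\beta_i\otimes_He_i\ (1\le i\le 3),\quad [e_1,e_1]=\alpha'_m\otimes_He_2,\quad [e_1,e_2]=\eta\otimes_He_2,\\ &[e_1,e_3]=\eta_{11}\otimes_He_1+\eta_{12}\otimes_He_2,\quad [e_2,e_3]=\eta_{21}\otimes_He_1+\eta_{22}\otimes_He_2,\quad [e_2,e_2]=[e_3,e_3]=0,\end{aligned}$$ where $\alpha=s\otimes1-1\otimes s$, $\beta_i=\lambda_is\otimes1-1\otimes s+\kappa_i\otimes1$ with $\lambda_i,\kappa_i\in\mathbf k$, $\eta,\eta_{ij}\in H\otimes H$, and for some $m\in\mathbb N$ (the type of $L$) either $m=0$ and $\alpha'_m=0$, or $m\ge1$ and $\alpha'_m=\sum_{0\le i,j\le m}c_{ij}s^{(i)}\otimes s^{(j)}$ with $c_{ij}\in\mathbf k$ and the $c_{im},c_{mj}$ not all zero. **Proposition.**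 Let $L$ be a Schrödinger–Virasoro Lie $H$-pseudoalgebra of type $m$, given by the table above, with $\eta_{ij}=0$ for all $1\le i,j\le2$. Then $\beta_3=\lambda_3s\otimes1-1\otimes s+\kappa_3\otimes1$ with $\lambda_3,\kappa_3\in\mathbf k$ arbitrary, and one of the following holds. (Z1) $m=0$, $\alpha'_m=0$, $\eta=a\otimes1$ with $a\in\mathbf k$, $a\lambda_1=a\kappa_1=0$ (and $\lambda_1,\lambda_2,\kappa_1,\kappa_2$ otherwise arbitrary). (Z2) $m=1$, $\alpha'_m=w(1\otimes s-s\otimes1)\ne0$, $\eta=a\otimes1$ with $a\in\mathbf k$, $a\lambda_1=a\kappa_1=0$, and $\lambda_2=2\lambda_1-1$, $\kappa_2=2\kappa_1$. (Z3) $m=2$, $\alpha'_m=-w\big(\kappa_1(1\otimes s^{(2)}-s^{(2)}\otimes1)-(s\otimes s^{(2)}-s^{(2)}\otimes s)-\tfrac{\kappa_1^2}2(1\otimes s-s\otimes1)\big)\ne0$, $\eta=0$, $\lambda_1=0$, $\lambda_2=-3$, $\kappa_2=2\kappa_1$. (Z4) $m=2$, $\alpha'_m=w\big((1\otimes s^{(2)}-s^{(2)}\otimes1)-\kappa_1(1\otimes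 s-s\otimes1)\big)\ne0$, $\eta=0$, $\lambda_1=\tfrac12$, $\lambda_2=-1$, $\kappa_2=2\kappa_1$. (Z5) $m=3$, $\alpha'_m=w\big((1\otimes s^{(3)}-s^{(3)}\otimes1)+\tfrac12(s\otimes s^{(2)}-s^{(2)}\otimes s)-\tfrac{3\kappa_1}2(1\otimes s^{(2)}-s^{(2)}\otimes1)+\tfrac34\kappa_1^2(1\otimes s-s\otimes1)\big)\ne0$, $\eta=0$, $\lambda_1=\tfrac23$, $\lambda_2=-\tfrac53$, $\kappa_2=2\kappa_1$. Here $w\in\mathbf k$. Conversely, for all values of the parameters as in one of (Z1)–(Z5), with $\eta_{ij}=0$, the free $H$-module with basis $e_0,e_1,e_2,e_3$ carries a pseudobracket with this table that makes it a Schrödinger–Virasoro Lie $H$-pseudoalgebra of type $m$. -/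

import Mathlib

open scoped Polynomial TensorProduct

noncomputable section

namespace SchrodingerVirasoro

/-! The Hopf algebra `H = k[s]` is the polynomial ring `k[X]`, with `s = X` primitive. -/

section Hopf

variable (k : Type*) [Field k]

/-- The algebra `H ⊗ H` (tensor product over `k`). It is a type synonym, because its structure of
an `H`-algebra below is the one through the coproduct, not the one through the first factor. -/
def H2 : Type _ := k[X] ⊗[k] k[X]

/-- The algebra `H ⊗ H ⊗ H`. -/
def H3 : Type _ := k[X] ⊗[k] (k[X] ⊗[k] k[X])

instance : CommRing (H2 k) := inferInstanceAs (CommRing (k[X] ⊗[k] k[X]))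
instance : Algebra k (H2 k) := inferInstanceAs (Algebra k (k[X] ⊗[k] k[X]))
instance : CommRing (H3 k) := inferInstanceAs (CommRing (k[X] ⊗[k] (k[X] ⊗[k] k[X])))
instance : Algebra k (H3 k) := inferInstanceAs (Algebra k (k[X] ⊗[k] (k[X] ⊗[k] k[X])))

variable {k}

/-- The element `f ⊗ g` of `H ⊗ H`. -/
def t2 (f g : k[X]) : H2 k := (f ⊗ₜ[k] g : k[X] ⊗[k] k[X])

/-- The element `f ⊗ g ⊗ h` of `H ⊗ H ⊗ H`. -/
def t3 (f g h : k[X]) : H3 k := (f ⊗ₜ[k] (g ⊗ₜ[k] h) : k[X] ⊗[k] (k[X] ⊗[k] k[X]))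

variable (k)

/-- The coproduct `Δ : H → H ⊗ H`, the algebra map with `Δ(s) = s ⊗ 1 + 1 ⊗ s`
(equivalently `Δ(s⁽ⁿ⁾) = ∑ s⁽ⁱ⁾ ⊗ s⁽ⁿ⁻ⁱ⁾` for the divided powers `s⁽ⁿ⁾ = sⁿ / n!`). -/
def comul : k[X] →ₐ[k] H2 k :=
  Polynomial.aeval (t2 Polynomial.X 1 + t2 1 Polynomial.X)

/-- `f ⊗ g ↦ f ⊗ g ⊗ 1`. -/
def inl12 : H2 k →ₐ[k] H3 k :=
  (Algebra.TensorProduct.map (AlgHom.id k k[X])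
    (Algebra.TensorProduct.includeLeft : k[X] →ₐ[k] k[X] ⊗[k] k[X]) :
    k[X] ⊗[k] k[X] →ₐ[k] k[X] ⊗[k] (k[X] ⊗[k] k[X]))

/-- `f ⊗ g ↦ 1 ⊗ f ⊗ g`. -/
def inr23 : H2 k →ₐ[k] H3 k :=
  (Algebra.TensorProduct.includeRight :
    k[X] ⊗[k] k[X] →ₐ[k] k[X] ⊗[k] (k[X] ⊗[k] k[X]))

/-- `Δ ⊗ 1 : f ⊗ g ↦ Δ(f) ⊗ g`. -/
def comulLeftₐ : H2 k →ₐ[k] H3 k :=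
  ((Algebra.TensorProduct.assoc k k k k[X] k[X] k[X]).toAlgHom.comp
    (Algebra.TensorProduct.map (comul k : k[X] →ₐ[k] k[X] ⊗[k] k[X]) (AlgHom.id k k[X])) :
    k[X] ⊗[k] k[X] →ₐ[k] k[X] ⊗[k] (k[X] ⊗[k] k[X]))

/-- `1 ⊗ Δ : f ⊗ g ↦ f ⊗ Δ(g)`. -/
def comulRightₐ : H2 k →ₐ[k] H3 k :=
  (Algebra.TensorProduct.map (AlgHom.id k k[X]) (comul k : k[X] →ₐ[k] k[X] ⊗[k] k[X]) :
    k[X] ⊗[k] k[X] →ₐ[k] k[X] ⊗[k] (k[X] ⊗[k] k[X]))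

/-- The flip `(12) : f ⊗ g ↦ g ⊗ f`. -/
def flipₐ : H2 k →ₐ[k] H2 k :=
  ((Algebra.TensorProduct.comm k k[X] k[X]).toAlgHom :
    k[X] ⊗[k] k[X] →ₐ[k] k[X] ⊗[k] k[X])

/-- The flip `(12) : f ⊗ g ⊗ h ↦ g ⊗ f ⊗ h` of the first two factors. -/
def flip12ₐ : H3 k →ₐ[k] H3 k :=
  ((Algebra.TensorProduct.leftComm k k[X] k[X] k[X]).toAlgHom :
    k[X] ⊗[k] (k[X] ⊗[k] k[X]) →ₐ[k] k[X] ⊗[k] (k[X] ⊗[k] k[X]))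

variable {k}

lemma comul_X : comul k Polynomial.X = t2 Polynomial.X 1 + t2 1 Polynomial.X := by
  simp [comul]

lemma inl12_t2 (f g : k[X]) : inl12 k (t2 f g) = t3 f g 1 := rfl

lemma inr23_t2 (f g : k[X]) : inr23 k (t2 f g) = t3 1 f g := rfl

lemma flip_t2 (f g : k[X]) : flipₐ k (t2 f g) = t2 g f := rfl

lemma flip12_t3 (f g h : k[X]) : flip12ₐ k (t3 f g h) = t3 g f h := rfl

lemma comulRight_t2_one (f : k[X]) : comulRightₐ k (t2 f 1) = t3 f 1 1 := by
  change (f ⊗ₜ[k] (comul k 1) : k[X] ⊗[k] (k[X] ⊗[k] k[X])) = _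
  rw [map_one]
  rfl

lemma comulRight_one_t2 (g : k[X]) : comulRightₐ k (t2 1 g) = inr23 k (comul k g) := rfl

lemma comulLeft_one_t2 (g : k[X]) : comulLeftₐ k (t2 1 g) = t3 1 1 g := by
  change (Algebra.TensorProduct.assoc k k k k[X] k[X] k[X])
    ((comul k 1 : k[X] ⊗[k] k[X]) ⊗ₜ[k] g) = _
  rw [map_one]
  rfl

lemma comulLeft_t2_one (f : k[X]) : comulLeftₐ k (t2 f 1) = inl12 k (comul k f) := by
  have key : ∀ F : k[X] ⊗[k] k[X],
      (Algebra.TensorProduct.assoc k k k k[X] k[X] k[X]) (F ⊗ₜ[k] 1) =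
      Algebra.TensorProduct.map (AlgHom.id k k[X])
        (Algebra.TensorProduct.includeLeft : k[X] →ₐ[k] k[X] ⊗[k] k[X]) F := by
    intro F
    induction F using TensorProduct.induction_on with
    | zero => rw [TensorProduct.zero_tmul, map_zero, map_zero]
    | tmul a b => rfl
    | add a b ha hb => rw [TensorProduct.add_tmul, map_add, map_add, ha, hb]
  exact key _

lemma coassoc : (comulLeftₐ k).comp (comul k) = (comulRightₐ k).comp (comul k) := by
  apply Polynomial.algHom_ext
  simp only [AlgHom.comp_apply, comul_X, map_add, comulLeft_t2_one, comulLeft_one_t2,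
    comulRight_t2_one, comulRight_one_t2, inl12_t2, inr23_t2]
  abel

lemma cocomm : (flipₐ k).comp (comul k) = comul k := by
  apply Polynomial.algHom_ext
  simp only [AlgHom.comp_apply, comul_X, map_add, flip_t2]
  abel

lemma flip12_coassoc :
    (flip12ₐ k).comp ((comulRightₐ k).comp (comul k)) = (comulRightₐ k).comp (comul k) := by
  apply Polynomial.algHom_ext
  simp only [AlgHom.comp_apply, comul_X, map_add, comulRight_t2_one, comulRight_one_t2, inr23_t2,
    flip12_t3]
  abel

/-- `H` acts on `H ⊗ H` through `Δ`. -/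
instance : Algebra k[X] (H2 k) := (comul k).toRingHom.toAlgebra

/-- `H` acts on `H ⊗ H ⊗ H` through the iterated coproduct `(1 ⊗ Δ)Δ = (Δ ⊗ 1)Δ`. -/
instance : Algebra k[X] (H3 k) := ((comulRightₐ k).comp (comul k)).toRingHom.toAlgebra

variable (k)

/-- `Δ ⊗ 1` as a map of `H`-algebras. -/
def comulLeft : H2 k →ₐ[k[X]] H3 k :=
  { (comulLeftₐ k).toRingHom with commutes' := fun h => DFunLike.congr_fun (coassoc (k := k)) h }

/-- `1 ⊗ Δ` as a map of `H`-algebras. -/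
def comulRight : H2 k →ₐ[k[X]] H3 k :=
  { (comulRightₐ k).toRingHom with commutes' := fun _ => rfl }

/-- `(12)` on `H ⊗ H` as a map of `H`-algebras. -/
def flip : H2 k →ₐ[k[X]] H2 k :=
  { (flipₐ k).toRingHom with commutes' := fun h => DFunLike.congr_fun (cocomm (k := k)) h }

/-- `(12)` on `H ⊗ H ⊗ H` as a map of `H`-algebras. -/
def flip12 : H3 k →ₐ[k[X]] H3 k :=
  { (flip12ₐ k).toRingHom with
    commutes' := fun h => DFunLike.congr_fun (flip12_coassoc (k := k)) h }

end Hopf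

section Pseudo

variable {k : Type*} [Field k] {L : Type*} [AddCommGroup L] [Module k[X] L]

/-- A pseudobracket on the `H`-module `L`: a biadditive map `L × L → H^{⊗2} ⊗_H L` with
`[f a, g b] = (f ⊗ g ⊗_H 1) [a, b]` for `f, g ∈ H` (in particular it is `k`-bilinear). -/
structure PseudoBracket (k : Type*) [Field k] (L : Type*) [AddCommGroup L] [Module k[X] L] where
  toFun : L →+ L →+ (H2 k ⊗[k[X]] L)
  map_smul : ∀ (f g : k[X]) (a b : L), toFun (f • a) (g • b) = t2 f g • toFun a b

/-- For an `H`-algebra map `φ : A → B`, the map `φ ⊗_H 1` is semilinear along `φ`. -/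
lemma rTensor_smul {A B : Type*} [CommRing A] [CommRing B] [Algebra k[X] A] [Algebra k[X] B]
    (φ : A →ₐ[k[X]] B) (F : A) (x : A ⊗[k[X]] L) :
    LinearMap.rTensor L φ.toLinearMap (F • x) = φ F • LinearMap.rTensor L φ.toLinearMap x := by
  induction x using TensorProduct.induction_on with
  | zero => simp
  | tmul a b => simp [TensorProduct.smul_tmul']
  | add a b ha hb => rw [smul_add, map_add, map_add, smul_add, ha, hb]

/-- `[x, c]` in `H^{⊗3} ⊗_H L` for `x ∈ H^{⊗2} ⊗_H L` and `c ∈ L`: if `x = ∑ Fᵢ ⊗_H aᵢ` and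
`[aᵢ, c] = ∑ Gᵢⱼ ⊗_H bᵢⱼ`, it is `∑ (Fᵢ ⊗ 1) (Δ ⊗ 1)(Gᵢⱼ) ⊗_H bᵢⱼ`. -/
def PseudoBracket.leftComp (ρ : PseudoBracket k L) (c : L) :
    H2 k ⊗[k[X]] L →+ H3 k ⊗[k[X]] L :=
  TensorProduct.liftAddHom
    (AddMonoidHom.mk' (fun F : H2 k => AddMonoidHom.mk'
        (fun a : L => inl12 k F • LinearMap.rTensor L (comulLeft k).toLinearMap (ρ.toFun a c))
        (fun a b => by simp only [map_add, AddMonoidHom.add_apply, smul_add]))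
      (fun F G => by ext a; simp [add_smul]))
    (fun h F a => by
      have h1 : ρ.toFun (h • a) c = t2 h 1 • ρ.toFun a c := by
        simpa using ρ.map_smul h 1 a c
      have h2 : comulLeft k (t2 h 1) = inl12 k (comul k h) := comulLeft_t2_one h
      have h3 : h • F = comul k h * F := Algebra.smul_def h F
      simp only [AddMonoidHom.mk'_apply]
      rw [h1, rTensor_smul, h2, h3, map_mul, smul_smul, mul_comm])

/-- `[a, x]` in `H^{⊗3} ⊗_H L` for `a ∈ L` and `x ∈ H^{⊗2} ⊗_H L`: if `x = ∑ Fᵢ ⊗_H bᵢ` and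
`[a, bᵢ] = ∑ Gᵢⱼ ⊗_H cᵢⱼ`, it is `∑ (1 ⊗ Fᵢ) (1 ⊗ Δ)(Gᵢⱼ) ⊗_H cᵢⱼ`. -/
def PseudoBracket.rightComp (ρ : PseudoBracket k L) (a : L) :
    H2 k ⊗[k[X]] L →+ H3 k ⊗[k[X]] L :=
  TensorProduct.liftAddHom
    (AddMonoidHom.mk' (fun F : H2 k => AddMonoidHom.mk'
        (fun b : L => inr23 k F • LinearMap.rTensor L (comulRight k).toLinearMap (ρ.toFun a b))
        (fun b c => by simp only [map_add, smul_add]))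
      (fun F G => by ext b; simp [add_smul]))
    (fun h F b => by
      have h1 : ρ.toFun a (h • b) = t2 1 h • ρ.toFun a b := by
        simpa using ρ.map_smul 1 h a b
      have h2 : comulRight k (t2 1 h) = inr23 k (comul k h) := comulRight_one_t2 h
      have h3 : h • F = comul k h * F := Algebra.smul_def h F
      simp only [AddMonoidHom.mk'_apply]
      rw [h1, rTensor_smul, h2, h3, map_mul, smul_smul, mul_comm])

/-- `L` with the pseudobracket `ρ` is a Lie `H`-pseudoalgebra: skew-commutativity
`[a, b] = -((12) ⊗_H 1)[b, a]` and the Jacobi identity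
`[[a, b], c] = [a, [b, c]] - ((12) ⊗_H 1)[b, [a, c]]`. -/
structure PseudoBracket.IsLie (ρ : PseudoBracket k L) : Prop where
  skew : ∀ a b : L,
    ρ.toFun a b = -LinearMap.rTensor L (flip k).toLinearMap (ρ.toFun b a)
  jacobi : ∀ a b c : L,
    ρ.leftComp c (ρ.toFun a b) = ρ.rightComp a (ρ.toFun b c)
      - LinearMap.rTensor L (flip12 k).toLinearMap (ρ.rightComp b (ρ.toFun a c))

end Pseudo

section Families

variable {k : Type*} [Field k]

/-- The divided power `s⁽ⁿ⁾ = sⁿ / n!`. -/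
def dp (k : Type*) [Field k] (n : ℕ) : k[X] := Polynomial.monomial n ((Nat.factorial n : k)⁻¹)

/-- `d i j = s⁽ⁱ⁾ ⊗ s⁽ʲ⁾`. -/
def d (k : Type*) [Field k] (i j : ℕ) : H2 k := t2 (dp k i) (dp k j)

/-- `α = s ⊗ 1 - 1 ⊗ s`. -/
def alpha (k : Type*) [Field k] : H2 k := d k 1 0 - d k 0 1

/-- `β = l s ⊗ 1 - 1 ⊗ s + c ⊗ 1`. -/
def beta (l c : k) : H2 k := l • d k 1 0 - d k 0 1 + c • d k 0 0

/-- The constants of the bracket table of a Schrödinger-Virasoro Lie `H`-pseudoalgebra: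
`βᵢ = lamᵢ s ⊗ 1 - 1 ⊗ s + kapᵢ ⊗ 1`, the element `α'`, and `η`, `ηᵢⱼ`. -/
structure Table (k : Type*) [Field k] where
  (lam1 lam2 lam3 kap1 kap2 kap3 : k)
  (alpha' eta eta11 eta12 eta21 eta22 : H2 k)

/-- `A` is an element `α'ₘ`: `α'₀ = 0`, and for `m > 0` it is
`∑_{0 ≤ i, j ≤ m} c i j s⁽ⁱ⁾ ⊗ s⁽ʲ⁾` where the `c i m` and the `c m j` do not all vanish. -/
def IsMType (m : ℕ) (A : H2 k) : Prop :=
  (m = 0 ∧ A = 0) ∨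
  (0 < m ∧ ∃ c : ℕ → ℕ → k,
    A = ∑ i ∈ Finset.range (m + 1), ∑ j ∈ Finset.range (m + 1), c i j • d k i j ∧
    ∃ i ≤ m, c i m ≠ 0 ∨ c m i ≠ 0)

/-- The free `H`-module `L` with basis `e 0, e 1, e 2, e 3` and pseudobracket `ρ` is a
Schrödinger-Virasoro Lie `H`-pseudoalgebra, whose subalgebra `H e₀ + H e₁ + H e₂` is of `m`-type,
with bracket table `T`. The brackets `[eᵢ, eⱼ]` with `i > j` are determined by skewness. -/
structure IsSchrodingerVirasoro {L : Type*} [AddCommGroup L] [Module k[X] L]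
    (e : Module.Basis (Fin 4) k[X] L) (ρ : PseudoBracket k L) (m : ℕ) (T : Table k) : Prop where
  isLie : ρ.IsLie
  mType : IsMType m T.alpha'
  b00 : ρ.toFun (e 0) (e 0) = alpha k ⊗ₜ[k[X]] e 0
  b01 : ρ.toFun (e 0) (e 1) = beta T.lam1 T.kap1 ⊗ₜ[k[X]] e 1
  b02 : ρ.toFun (e 0) (e 2) = beta T.lam2 T.kap2 ⊗ₜ[k[X]] e 2
  b03 : ρ.toFun (e 0) (e 3) = beta T.lam3 T.kap3 ⊗ₜ[k[X]] e 3
  b11 : ρ.toFun (e 1) (e 1) = T.alpha' ⊗ₜ[k[X]] e 2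
  b12 : ρ.toFun (e 1) (e 2) = T.eta ⊗ₜ[k[X]] e 2
  b13 : ρ.toFun (e 1) (e 3) = T.eta11 ⊗ₜ[k[X]] e 1 + T.eta12 ⊗ₜ[k[X]] e 2
  b23 : ρ.toFun (e 2) (e 3) = T.eta21 ⊗ₜ[k[X]] e 1 + T.eta22 ⊗ₜ[k[X]] e 2
  b22 : ρ.toFun (e 2) (e 2) = 0
  b33 : ρ.toFun (e 3) (e 3) = 0

/-- `α' = 0`, `η = a ⊗ 1` with `a λ₁ = a κ₁ = 0`; all `λᵢ, κᵢ` otherwise arbitrary. -/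
def IsZ1 (T : Table k) : Prop :=
  T.alpha' = 0 ∧ ∃ a : k, T.eta = a • d k 0 0 ∧ a * T.lam1 = 0 ∧ a * T.kap1 = 0

def IsZ2 (T : Table k) : Prop :=
  (∃ w : k, T.alpha' = w • (d k 0 1 - d k 1 0)) ∧ T.alpha' ≠ 0 ∧
  (∃ a : k, T.eta = a • d k 0 0 ∧ a * T.lam1 = 0 ∧ a * T.kap1 = 0) ∧
  T.lam2 = 2 * T.lam1 - 1 ∧ T.kap2 = 2 * T.kap1

def IsZ3 (T : Table k) : Prop :=
  (∃ w : k, T.alpha' = -w • (T.kap1 • (d k 0 2 - d k 2 0) - (d k 1 2 - d k 2 1)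
    - (T.kap1 ^ 2 / 2) • (d k 0 1 - d k 1 0))) ∧ T.alpha' ≠ 0 ∧
  T.eta = 0 ∧ T.lam1 = 0 ∧ T.lam2 = -3 ∧ T.kap2 = 2 * T.kap1

def IsZ4 (T : Table k) : Prop :=
  (∃ w : k, T.alpha' = w • ((d k 0 2 - d k 2 0) - T.kap1 • (d k 0 1 - d k 1 0))) ∧
  T.alpha' ≠ 0 ∧
  T.eta = 0 ∧ T.lam1 = 1 / 2 ∧ T.lam2 = -1 ∧ T.kap2 = 2 * T.kap1

def IsZ5 (T : Table k) : Prop :=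
  (∃ w : k, T.alpha' = w • ((d k 0 3 - d k 3 0) + (1 / 2 : k) • (d k 1 2 - d k 2 1)
    - (3 * T.kap1 / 2) • (d k 0 2 - d k 2 0)
    + (3 / 4 * T.kap1 ^ 2) • (d k 0 1 - d k 1 0))) ∧ T.alpha' ≠ 0 ∧
  T.eta = 0 ∧ T.lam1 = 2 / 3 ∧ T.lam2 = -5 / 3 ∧ T.kap2 = 2 * T.kap1

end Families

end SchrodingerVirasoro

end

/-! An element of `H2 k` is a polynomial in two variables. As `k` is infinite it is determined by
its values (`H2_ext`, `H3_ext`), and under evaluation the coproduct becomes addition of variables.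
Since `L` is free, each Jacobi identity between basis elements is then a polynomial identity over
`k`. For vanishing `ηᵢⱼ` the conditions that are not automatic are those in `IsCompatible`; `β₃`
does not occur in them, so `λ₃, κ₃` are free. They also suffice, because the Lie axioms are
sesquilinear and can be tested on a basis (`isLie_of_basis`).

For `η`, the identity for `e₁, e₁, e₂` excludes dependence on the second variable by a degree count,
and the action of `e₀` then forces a constant `a` with `aλ₁ = aκ₁ = 0` (`eta_constant`).

For `α' ≠ 0`, the action of `e₀` gives `κ₂ = 2κ₁`, and translating both variables by `κ₁` removes
the constants. The restriction `f(z) = a(0, z)` of the translated solution satisfies the Euler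
equation `z f' = (2λ₁ - λ₂) f`, so a nonzero `f` is a monomial `w z^N` (`euler_ode`). If `λ₁ ≠ 0`,
then `f` determines `a`, and skewness leaves `N = 1` or `(N, λ₁) = (2, 1/2), (3, 2/3)`
(`exponent_le_three`). If `λ₁ = 0` and `f ≠ 0`, then `1 + N = 2^N` forces `N = 1`. If `f = 0`, the
normal derivative along the axis takes its place, and `K + 2 = 2^K` gives the solution of (Z3)
(`solution_axes_zero`). These cases are assembled in `skew_solutions`. Finally `aλ₁ = 0` kills `η`
in (Z4) and (Z5), and the identity for `e₁, e₁, e₁` kills it in (Z3). -/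

noncomputable section

namespace SchrodingerVirasoro

/-! ### Elements of `H ⊗ H` and `H ⊗ H ⊗ H` as polynomial functions -/

section Evaluation

variable {k : Type*} [Field k] {R : Type*} [CommRing R] [Algebra k R]

/-- Evaluation `f ⊗ g ↦ f(u) g(v)`. -/
def ev2 (u v : R) : H2 k →ₐ[k] R :=
  (Algebra.TensorProduct.productMap (Polynomial.aeval u) (Polynomial.aeval v) :
    k[X] ⊗[k] k[X] →ₐ[k] R)

/-- Evaluation `f ⊗ g ⊗ h ↦ f(u) g(v) h(w)`. -/
def ev3 (u v w : R) : H3 k →ₐ[k] R :=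
  (Algebra.TensorProduct.productMap (Polynomial.aeval u)
    (Algebra.TensorProduct.productMap (Polynomial.aeval v) (Polynomial.aeval w)) :
    k[X] ⊗[k] (k[X] ⊗[k] k[X]) →ₐ[k] R)

@[simp] lemma ev2_t2 (u v : R) (f g : k[X]) :
    ev2 u v (t2 f g) = Polynomial.aeval u f * Polynomial.aeval v g :=
  Algebra.TensorProduct.productMap_apply_tmul _ _ _ _

@[simp] lemma ev3_t3 (u v w : R) (f g h : k[X]) :
    ev3 u v w (t3 f g h) =
      Polynomial.aeval u f * (Polynomial.aeval v g * Polynomial.aeval w h) := by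
  refine (Algebra.TensorProduct.productMap_apply_tmul _ _ _ _).trans ?_
  rw [Algebra.TensorProduct.productMap_apply_tmul]

/-- Algebra maps out of `H ⊗ H` are determined by the two generators. -/
lemma H2_algHom_ext {φ ψ : H2 k →ₐ[k] R} (h₁ : φ (t2 Polynomial.X 1) = ψ (t2 Polynomial.X 1))
    (h₂ : φ (t2 1 Polynomial.X) = ψ (t2 1 Polynomial.X)) : φ = ψ :=
  Algebra.TensorProduct.ext (A := k[X]) (B := k[X]) (S := k)
    (Polynomial.algHom_ext h₁) (Polynomial.algHom_ext h₂)

lemma ev3_inl12 (u v w : R) (F : H2 k) : ev3 u v w (inl12 k F) = ev2 u v F := by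
  refine DFunLike.congr_fun
    (H2_algHom_ext (φ := (ev3 u v w).comp (inl12 k)) (ψ := ev2 u v) ?_ ?_) F <;>
  simp [inl12_t2]

lemma ev3_inr23 (u v w : R) (F : H2 k) : ev3 u v w (inr23 k F) = ev2 v w F := by
  refine DFunLike.congr_fun
    (H2_algHom_ext (φ := (ev3 u v w).comp (inr23 k)) (ψ := ev2 v w) ?_ ?_) F <;>
  simp [inr23_t2]

lemma ev3_comulLeftₐ (u v w : R) (F : H2 k) :
    ev3 u v w (comulLeftₐ k F) = ev2 (u + v) w F := by
  refine DFunLike.congr_fun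
    (H2_algHom_ext (φ := (ev3 u v w).comp (comulLeftₐ k)) (ψ := ev2 (u + v) w) ?_ ?_) F <;>
  simp [comulLeft_t2_one, comulLeft_one_t2, comul_X, inl12_t2]

lemma ev3_comulRightₐ (u v w : R) (F : H2 k) :
    ev3 u v w (comulRightₐ k F) = ev2 u (v + w) F := by
  refine DFunLike.congr_fun
    (H2_algHom_ext (φ := (ev3 u v w).comp (comulRightₐ k)) (ψ := ev2 u (v + w)) ?_ ?_) F <;>
  simp [comulRight_t2_one, comulRight_one_t2, comul_X, inr23_t2]

lemma ev2_flipₐ (u v : R) (F : H2 k) : ev2 u v (flipₐ k F) = ev2 v u F := by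
  refine DFunLike.congr_fun
    (H2_algHom_ext (φ := (ev2 u v).comp (flipₐ k)) (ψ := ev2 v u) ?_ ?_) F <;>
  simp [flip_t2]

lemma ev3_comulLeft (u v w : R) (F : H2 k) :
    ev3 u v w (comulLeft k F) = ev2 (u + v) w F := ev3_comulLeftₐ u v w F

lemma ev3_comulRight (u v w : R) (F : H2 k) :
    ev3 u v w (comulRight k F) = ev2 u (v + w) F := ev3_comulRightₐ u v w F

lemma ev2_flip (u v : R) (F : H2 k) : ev2 u v (flip k F) = ev2 v u F := ev2_flipₐ u v F

lemma ev3_flip12 (u v w : R) (F : H3 k) : ev3 u v w (flip12 k F) = ev3 v u w F := by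
  change ev3 u v w (flip12ₐ k F) = _
  have : (ev3 u v w).comp (flip12ₐ k) = ev3 v u w := by
    refine Algebra.TensorProduct.ext (A := k[X]) (B := k[X] ⊗[k] k[X]) (S := k)
      (Polynomial.algHom_ext ?_) (H2_algHom_ext ?_ ?_)
    · change ev3 u v w (flip12ₐ k (t3 Polynomial.X 1 1)) = ev3 v u w (t3 Polynomial.X 1 1)
      simp [flip12_t3]
    · change ev3 u v w (flip12ₐ k (t3 1 Polynomial.X 1)) = ev3 v u w (t3 1 Polynomial.X 1)
      simp [flip12_t3]
    · change ev3 u v w (flip12ₐ k (t3 1 1 Polynomial.X)) = ev3 v u w (t3 1 1 Polynomial.X)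
      simp [flip12_t3]
  exact DFunLike.congr_fun this F

/-- Evaluation commutes with algebra maps. -/
lemma map_ev2 {S : Type*} [CommRing S] [Algebra k S] (φ : R →ₐ[k] S) (u v : R) (F : H2 k) :
    φ (ev2 u v F) = ev2 (φ u) (φ v) F := by
  refine DFunLike.congr_fun
    (H2_algHom_ext (φ := φ.comp (ev2 u v)) (ψ := ev2 (φ u) (φ v)) ?_ ?_) F <;>
  simp

lemma ev2_d (u v : R) (i j : ℕ) :
    ev2 u v (d k i j) =
      algebraMap k R ((i.factorial : k)⁻¹ * (j.factorial : k)⁻¹) * (u ^ i * v ^ j) := by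
  simp only [d, dp, ev2_t2, Polynomial.aeval_monomial, map_mul]
  ring

/-- Partial evaluation of the first tensor factor at a scalar. -/
def evFirst (M : Type*) [AddCommGroup M] [Module k M] (x : k) : k[X] ⊗[k] M →ₗ[k] M :=
  (TensorProduct.lid k M).toLinearMap ∘ₗ
    LinearMap.rTensor M (Polynomial.aeval x : k[X] →ₐ[k] k).toLinearMap

lemma evFirst_tmul (M : Type*) [AddCommGroup M] [Module k M] (x : k) (f : k[X]) (m : M) :
    evFirst M x (f ⊗ₜ m) = f.eval x • m := by
  simp [evFirst, Polynomial.aeval_def, Polynomial.eval₂_eq_eval_map]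

/-- Expanding in monomials of the first factor gives coefficients in `M`. Any linear functional on
`M` turns them into the coefficients of a polynomial with infinitely many zeros, and functionals
separate the points of `M`. -/
lemma eq_zero_of_evFirst [Infinite k] {M : Type*} [AddCommGroup M] [Module k M]
    {F : k[X] ⊗[k] M} (h : ∀ x, evFirst M x F = 0) : F = 0 := by
  set b := Polynomial.basisMonomials k
  set E := TensorProduct.equivFinsuppOfBasisLeft (N := M) b
  obtain ⟨c, rfl⟩ := E.symm.surjective F
  have hc : E.symm c = c.sum fun i m => b i ⊗ₜ[k] m :=
    TensorProduct.equivFinsuppOfBasisLeft_symm_apply b c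
  suffices c = 0 by simp [this]
  ext i
  rw [Finsupp.zero_apply, ← Module.forall_dual_apply_eq_zero_iff k]
  intro φ
  have hp : ∑ j ∈ c.support, Polynomial.monomial j (φ (c j)) = 0 := by
    refine Polynomial.funext fun x => ?_
    have := congrArg φ (h x)
    rw [hc, Finsupp.sum, map_sum, map_sum, map_zero] at this
    rw [Polynomial.eval_finsetSum, Polynomial.eval_zero, ← this]
    refine Finset.sum_congr rfl fun j _ => ?_
    simp [b, evFirst_tmul, mul_comm]
  have := congrArg (Polynomial.coeff · i) hp
  simp only [Polynomial.finsetSum_coeff, Polynomial.coeff_monomial, Polynomial.coeff_zero,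
    Finset.sum_ite_eq', Finsupp.mem_support_iff] at this
  by_cases hi : c i = 0
  · simp [hi]
  · simpa [hi] using this

lemma ev2_eq_eval_evFirst (x y : k) (F : H2 k) :
    ev2 x y F = Polynomial.eval y (evFirst k[X] x F) := by
  induction F using TensorProduct.induction_on with
  | zero => rw [map_zero, Polynomial.eval_zero]; exact (map_zero (ev2 (R := k) x y))
  | tmul f g =>
    rw [evFirst_tmul]
    refine (ev2_t2 x y f g).trans ?_
    simp [Polynomial.aeval_def, Polynomial.eval₂_eq_eval_map]
  | add a b ha hb =>
    rw [map_add, Polynomial.eval_add, ← ha, ← hb]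
    exact map_add (ev2 (R := k) x y) _ _

lemma ev3_eq_ev2_evFirst (x y z : k) (F : H3 k) :
    ev3 x y z F = ev2 y z (evFirst (k[X] ⊗[k] k[X]) x F : H2 k) := by
  induction F using TensorProduct.induction_on with
  | zero => rw [map_zero]; exact (map_zero (ev3 x y z)).trans (map_zero (ev2 y z)).symm
  | tmul f g =>
    rw [evFirst_tmul]
    refine (Algebra.TensorProduct.productMap_apply_tmul _ _ _ _).trans ?_
    refine Eq.trans ?_ (map_smul (ev2 y z) (f.eval x) (g : H2 k)).symm
    rw [smul_eq_mul, Polynomial.coe_aeval_eq_eval]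
    rfl
  | add a b ha hb =>
    rw [map_add]
    exact (map_add (ev3 x y z) _ _).trans ((congrArg₂ _ ha hb).trans (map_add (ev2 y z) _ _).symm)

lemma H2_ext [Infinite k] {F G : H2 k} (h : ∀ x y : k, ev2 x y F = ev2 x y G) : F = G := by
  rw [← sub_eq_zero]
  refine eq_zero_of_evFirst (M := k[X]) fun x => Polynomial.funext fun y => ?_
  rw [← ev2_eq_eval_evFirst, map_sub, h, sub_self, Polynomial.eval_zero]

lemma H3_ext [Infinite k] {F G : H3 k} (h : ∀ x y z : k, ev3 x y z F = ev3 x y z G) :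
    F = G := by
  rw [← sub_eq_zero]
  refine eq_zero_of_evFirst (M := k[X] ⊗[k] k[X]) fun x => H2_ext fun y z => ?_
  refine (ev3_eq_ev2_evFirst x y z (F - G)).symm.trans ?_
  rw [map_sub, h, sub_self]
  exact (map_zero (ev2 y z)).symm

end Evaluation

/-! ### The type `m` as an invariant of `α'` -/

section MType

variable {k : Type*} [Field k]

/-- The coefficient of `sⁱ ⊗ sʲ`. -/
def coeff2 (i j : ℕ) (F : H2 k) : k :=
  ((ev2 Polynomial.X (Polynomial.C Polynomial.X) F : k[X][X]).coeff i).coeff j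

lemma coeff2_sum (m : ℕ) (c : ℕ → ℕ → k) (a b : ℕ) :
    coeff2 a b (∑ i ∈ Finset.range (m + 1), ∑ j ∈ Finset.range (m + 1), c i j • d k i j) =
      if a ≤ m ∧ b ≤ m then c a b * ((a.factorial : k)⁻¹ * (b.factorial : k)⁻¹) else 0 := by
  have key : ∀ i j, coeff2 a b (c i j • d k i j) = if i = a then
      if j = b then c i j * ((i.factorial : k)⁻¹ * (j.factorial : k)⁻¹) else 0 else 0 := by
    intro i j
    have : (ev2 Polynomial.X (Polynomial.C Polynomial.X) (c i j • d k i j) : k[X][X]) =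
        Polynomial.monomial i (Polynomial.monomial j
          (c i j * ((i.factorial : k)⁻¹ * (j.factorial : k)⁻¹))) := by
      rw [map_smul, ev2_d, Algebra.smul_def, ← mul_assoc, ← map_mul,
        ← Polynomial.C_mul_X_pow_eq_monomial, ← Polynomial.C_mul_X_pow_eq_monomial,
        Polynomial.algebraMap_apply, Polynomial.algebraMap_apply]
      simp only [Algebra.algebraMap_self, RingHom.id_apply, map_mul, map_pow]
      ring
    rw [coeff2, this, Polynomial.coeff_monomial]
    split_ifs <;> simp_all [Polynomial.coeff_monomial]
  have hadd : coeff2 a b (∑ i ∈ Finset.range (m + 1), ∑ j ∈ Finset.range (m + 1),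
      c i j • d k i j) = ∑ i ∈ Finset.range (m + 1), ∑ j ∈ Finset.range (m + 1),
      coeff2 a b (c i j • d k i j) := by
    simp only [coeff2, map_sum, Polynomial.finsetSum_coeff]
  rw [hadd]
  simp only [key]
  by_cases ha : a ≤ m <;> by_cases hb : b ≤ m <;>
    simp [Finset.sum_ite_eq', Finset.sum_ite_irrel, ha, hb]

/-- This makes `m` intrinsic: it is the largest exponent of either variable occurring in `A`.
Characteristic zero keeps the factorials of the divided powers invertible. -/
lemma IsMType.coeff2 [CharZero k] {m : ℕ} {A : H2 k} (h : IsMType m A) (hA : A ≠ 0) :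
    (∀ i j, coeff2 i j A ≠ 0 → i ≤ m ∧ j ≤ m) ∧
      ∃ i, coeff2 i m A ≠ 0 ∨ coeff2 m i A ≠ 0 := by
  obtain ⟨-, h0⟩ | ⟨-, c, rfl, i, hi, hc⟩ := h
  · exact absurd h0 hA
  refine ⟨fun a b hab => ?_, i, ?_⟩
  · rw [coeff2_sum] at hab
    by_contra hn
    exact hab (if_neg hn)
  · simpa [coeff2_sum, hi, Nat.factorial_ne_zero] using hc

/-- The type of a nonzero element is unique. -/
lemma IsMType.unique [CharZero k] {m n : ℕ} {A : H2 k} (hm : IsMType m A) (hn : IsMType n A)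
    (hA : A ≠ 0) :
    m = n := by
  obtain ⟨h1, i, h2⟩ := hm.coeff2 hA
  obtain ⟨h3, j, h4⟩ := hn.coeff2 hA
  apply le_antisymm
  · rcases h2 with h | h
    exacts [(h3 _ _ h).2, (h3 _ _ h).1]
  · rcases h4 with h | h
    exacts [(h1 _ _ h).2, (h1 _ _ h).1]

lemma IsMType.eq_zero_iff [CharZero k] {m : ℕ} {A : H2 k} (h : IsMType m A) : A = 0 ↔ m = 0 := by
  constructor
  · rintro rfl
    obtain ⟨h0, -⟩ | ⟨-, c, h0, i, hi, hc⟩ := h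
    · exact h0
    exfalso
    have hz : ∀ a b, SchrodingerVirasoro.coeff2 a b (0 : H2 k) = 0 := by
      simp [SchrodingerVirasoro.coeff2]
    have h1 := hz i m
    have h2 := hz m i
    rw [h0, coeff2_sum] at h1 h2
    simp [hi, Nat.factorial_ne_zero] at h1 h2
    tauto
  · rintro rfl
    obtain ⟨-, h0⟩ | ⟨h0, -⟩ := h
    · exact h0
    · exact absurd h0 (lt_irrefl _)

end MType

/-! ### Polynomial functional equations for `α'` and `η` -/

section FunctionalEquations

variable {k : Type*} [Field k] [CharZero k]

/-- Polynomial solutions of `z f' = c f` are monomials. -/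
lemma euler_ode {f : k[X]} (hf : f ≠ 0) {c : k}
    (h : ∀ z, z * f.derivative.eval z = c * f.eval z) :
    ∃ (N : ℕ) (w : k), w ≠ 0 ∧ c = N ∧ ∀ z, f.eval z = w * z ^ N := by
  have hp : Polynomial.X * f.derivative = Polynomial.C c * f :=
    Polynomial.funext fun z => by simpa using h z
  have hcoeff : ∀ n : ℕ, (n : k) * f.coeff n = c * f.coeff n := by
    intro n
    have := congrArg (Polynomial.coeff · n) hp
    rcases n with _ | n
    · simpa using this
    · simp only [Polynomial.coeff_X_mul, Polynomial.coeff_derivative, Polynomial.coeff_C_mul] at this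
      rw [← this]; push_cast; ring
  have hl : f.leadingCoeff ≠ 0 := Polynomial.leadingCoeff_ne_zero.2 hf
  have hc : c = f.natDegree := (mul_right_cancel₀ hl (hcoeff f.natDegree)).symm
  have hf' : f = Polynomial.monomial f.natDegree f.leadingCoeff := by
    ext n
    rw [Polynomial.coeff_monomial]
    split_ifs with hn
    · rw [← hn]; rfl
    -- Two nonzero coefficients in degrees `n` and `natDegree` would both have `c` as their degree,
    -- which characteristic zero excludes.
    · by_contra h0
      have h1 := mul_right_cancel₀ h0 (hcoeff n)
      rw [hc] at h1
      exact hn (Nat.cast_injective h1).symm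
  refine ⟨f.natDegree, f.leadingCoeff, hl, hc, fun z => ?_⟩
  conv_lhs => rw [hf']
  simp

lemma two_pow_gt (n : ℕ) (hn : 3 ≤ n) : 2 * (n + 2) < 2 ^ (n + 1) := by
  induction n, hn using Nat.le_induction with
  | base => norm_num
  | succ n _ ih => rw [pow_succ]; omega

lemma one_add_lt_two_pow (n : ℕ) (hn : 2 ≤ n) : 1 + n < 2 ^ n := by
  induction n, hn using Nat.le_induction with
  | base => norm_num
  | succ n _ ih => rw [pow_succ]; omega

/-- Comparison of the coefficients of `x²` and `x³`. -/
lemma exponent_le_three {l l' : k} {N : ℕ} (hN : l' = 2 * l - N)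
    (h : ∀ x : k, (l' * x - 1) + (l' - x) * x ^ (N + 1) = (2 * l * x - 1 - x ^ 2) * (x + 1) ^ N) :
    N ≤ 1 ∨ (N = 2 ∧ l = 1 / 2) ∨ (N = 3 ∧ l = 2 / 3) := by
  have hp : (Polynomial.C l' * Polynomial.X ^ 1 - 1) +
      (Polynomial.C l' * Polynomial.X ^ (N + 1) - Polynomial.X ^ (N + 2)) =
      Polynomial.C (2 * l) * ((Polynomial.X + 1) ^ N * Polynomial.X ^ 1)
        - (Polynomial.X + 1) ^ N - (Polynomial.X + 1) ^ N * Polynomial.X ^ 2 := by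
    refine Polynomial.funext fun x => ?_
    have := h x
    simp only [Polynomial.eval_add, Polynomial.eval_sub, Polynomial.eval_mul, Polynomial.eval_C,
      Polynomial.eval_pow, Polynomial.eval_X, Polynomial.eval_one]
    linear_combination this
  have c2 := congrArg (Polynomial.coeff · 2) hp
  have c3 := congrArg (Polynomial.coeff · 3) hp
  simp only [Polynomial.coeff_add, Polynomial.coeff_sub, Polynomial.coeff_C_mul,
    Polynomial.coeff_X_pow, Polynomial.coeff_one, Polynomial.coeff_mul_X_pow',
    Polynomial.coeff_X_add_one_pow] at c2 c3
  rcases Nat.lt_or_ge N 4 with h4 | h4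
  · interval_cases N
    · simp
    · simp
    · right; left
      refine ⟨rfl, ?_⟩
      norm_num [Nat.choose] at c2
      linear_combination -(1 / 4 : k) * c2
    · right; right
      refine ⟨rfl, ?_⟩
      norm_num [Nat.choose] at c2
      linear_combination -(1 / 6 : k) * c2
  · exfalso
    obtain ⟨M, rfl⟩ := Nat.exists_eq_add_of_le' h4
    have hc2 : ((M + 4).choose 2 : k) * 2 = (M + 4) * (M + 3) := by
      have := Nat.descFactorial_eq_factorial_mul_choose (M + 4) 2
      simp [Nat.descFactorial, Nat.factorial] at this
      have h' := congrArg (Nat.cast : ℕ → k) this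
      push_cast at h'
      linear_combination -h'
    have hc3 : ((M + 4).choose 3 : k) * 6 = (M + 4) * (M + 3) * (M + 2) := by
      have := Nat.descFactorial_eq_factorial_mul_choose (M + 4) 3
      simp [Nat.descFactorial, Nat.factorial] at this
      have h' := congrArg (Nat.cast : ℕ → k) this
      push_cast at h'
      linear_combination -h'
    norm_num at c2 c3
    have hM : (M + 4 : k) ≠ 0 := by exact_mod_cast (M + 3).succ_ne_zero
    -- With `N = M + 4` the two coefficients read `2lN = C(N,2) + 1` and `2l C(N,2) = C(N,3) + N`.
    -- Eliminating `l` gives `N (N - 3)(N + 1)(N + 2) = 0`.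
    have : ((M + 1) * (M + 5) * (M + 6) : k) = 0 := by
      refine mul_left_cancel₀ hM ?_
      have e2 : ((M + 4).choose 2 : k) = (M + 4) * (M + 3) / 2 := by linear_combination hc2 / 2
      have e3 : ((M + 4).choose 3 : k) = (M + 4) * (M + 3) * (M + 2) / 6 := by
        linear_combination hc3 / 6
      rw [if_neg (by omega), e2] at c2
      rw [if_neg (by omega), e2, e3] at c3
      linear_combination -12 * ((M + 4) * c3 - (M + 4) * (M + 3) / 2 * c2)
    have h' : ((M + 1) * (M + 5) * (M + 6) : ℕ) ≠ 0 := by positivity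
    exact h' (by exact_mod_cast this)

variable {p : k[X][X]} {a : k → k → k} {l l' : k}

/-- The partial evaluation `y ↦ a y z` as a polynomial. -/
lemma eval_slice {k : Type*} [Field k] {p : k[X][X]} {a : k → k → k}
    (ha : ∀ y z, p.evalEval z y = a y z) (y z : k) :
    (p.map (Polynomial.evalRingHom z)).eval y = a y z := by
  rw [← ha, Polynomial.map_evalRingHom_eval]

/-- Solutions vanishing on the axes, for `l = 0`. -/
lemma solution_axes_zero (ha : ∀ y z, p.evalEval z y = a y z) (hs : ∀ y z, a y z = -a z y)
    (h : ∀ x y z, -y * a (x + y) z - z * a y (x + z) = (l' * x - y - z) * a y z)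
    (h0 : ∀ z, a 0 z = 0) :
    (∀ y z, a y z = 0) ∨ (l' = -3 ∧ ∃ w, ∀ y z, a y z = w * (y * z * (z - y))) := by
  -- The outer variable of `p` is the first argument of `a`, so `g(z)` is the derivative of `a` in
  -- that argument at `(0, z)`.
  set g := p.coeff 1
  have hg : ∀ z, (p.map (Polynomial.evalRingHom z)).derivative.eval 0 = g.eval z := by
    intro z
    rw [← Polynomial.coeff_zero_eq_eval_zero, Polynomial.coeff_derivative]
    simp [g]
  -- The derivative of the equation in `y` at `y = 0`; it shows that `g` determines `a`.
  have h1 : ∀ x z, a x z = (-l' * x + z) * g.eval z - z * g.eval (x + z) := by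
    intro x z
    have hp : -Polynomial.X * (p.map (Polynomial.evalRingHom z)).comp
          (Polynomial.C x + Polynomial.X) -
        Polynomial.C z * p.map (Polynomial.evalRingHom (x + z)) -
        (Polynomial.C (l' * x - z) - Polynomial.X) * p.map (Polynomial.evalRingHom z) = 0 := by
      refine Polynomial.funext fun y => ?_
      simp only [Polynomial.eval_sub, Polynomial.eval_mul, Polynomial.eval_neg, Polynomial.eval_X,
        Polynomial.eval_comp, Polynomial.eval_add, Polynomial.eval_C, eval_slice ha,
        Polynomial.eval_zero]
      linear_combination h x y z
    have := congrArg (fun q => q.derivative.eval 0) hp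
    simp only [Polynomial.derivative_sub, Polynomial.derivative_mul, Polynomial.derivative_neg,
      Polynomial.derivative_X, Polynomial.derivative_C, Polynomial.derivative_comp,
      Polynomial.eval_sub, Polynomial.eval_mul, Polynomial.eval_neg, Polynomial.eval_X,
      Polynomial.eval_comp, Polynomial.eval_add, Polynomial.eval_C, eval_slice ha,
      Polynomial.eval_zero, Polynomial.eval_one, hg, h0, add_zero, Polynomial.derivative_zero] at this
    linear_combination -this
  by_cases hg0 : g = 0
  · left
    intro y z
    simp [h1, hg0]
  right
  -- The derivative of `h1` in `x` at `x = 0`.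
  have hode : ∀ z, z * g.derivative.eval z = (-l' - 1) * g.eval z := by
    intro z
    have hp : p.map (Polynomial.evalRingHom z) -
        (Polynomial.C (-l') * Polynomial.X + Polynomial.C z) * Polynomial.C (g.eval z) +
        Polynomial.C z * g.comp (Polynomial.X + Polynomial.C z) = 0 := by
      refine Polynomial.funext fun x => ?_
      simp only [Polynomial.eval_sub, Polynomial.eval_mul, Polynomial.eval_X,
        Polynomial.eval_comp, Polynomial.eval_add, Polynomial.eval_C, eval_slice ha,
        Polynomial.eval_zero, h1 x z]
      ring
    have := congrArg (fun q => q.derivative.eval 0) hp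
    simp only [Polynomial.derivative_sub, Polynomial.derivative_add, Polynomial.derivative_mul,
      Polynomial.derivative_X, Polynomial.derivative_C, Polynomial.derivative_comp,
      Polynomial.eval_sub, Polynomial.eval_mul, Polynomial.eval_X,
      Polynomial.eval_comp, Polynomial.eval_add, Polynomial.eval_C,
      Polynomial.eval_zero, Polynomial.eval_one, hg, zero_add, Polynomial.derivative_zero] at this
    linear_combination this
  obtain ⟨K, w, hw, hK, hgw⟩ := euler_ode hg0 hode
  -- Skewness on the diagonal gives `a(1, 1) = 0`, which becomes `K + 2 = 2^K`.
  have hsk := hs 1 1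
  rw [h1 1 1, hgw, hgw] at hsk
  have hK2 : K = 2 := by
    have h2 : (2 * (K + 2) : k) = 2 ^ (K + 1) := by
      refine mul_left_cancel₀ hw ?_
      rw [one_pow, one_add_one_eq_two] at hsk
      rw [pow_succ]
      linear_combination hsk - 2 * w * hK
    have h3 : 2 * (K + 2) = 2 ^ (K + 1) := by exact_mod_cast h2
    rcases Nat.lt_or_ge K 3 with h4 | h4
    · clear hsk hK hgw
      interval_cases K <;> first | rfl | exact absurd h3 (by norm_num)
    · exact absurd h3 (two_pow_gt K h4).ne
  subst hK2
  push_cast at hK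
  have hl' : l' = -3 := by linear_combination -hK
  refine ⟨hl', w, fun y z => ?_⟩
  rw [h1, hgw, hgw, hl']
  ring

/-- Invariant skew-symmetric bilinear polynomials. -/
theorem skew_solutions (ha : ∀ y z, p.evalEval z y = a y z) (hs : ∀ y z, a y z = -a z y)
    (h : ∀ x y z, (l * x - y) * a (x + y) z + (l * x - z) * a y (x + z) =
      (l' * x - y - z) * a y z) (hne : ∃ y z, a y z ≠ 0) :
    (l' = 2 * l - 1 ∧ ∃ w, ∀ y z, a y z = w * (z - y)) ∨
    (l = 0 ∧ l' = -3 ∧ ∃ w, ∀ y z, a y z = w * (y * z * (z - y))) ∨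
    (l = 1 / 2 ∧ l' = -1 ∧ ∃ w, ∀ y z, a y z = w * (z ^ 2 - y ^ 2)) ∨
    (l = 2 / 3 ∧ l' = -5 / 3 ∧ ∃ w, ∀ y z, a y z =
      w * (z ^ 3 + 3 / 2 * (y * z ^ 2) - 3 / 2 * (y ^ 2 * z) - y ^ 3)) := by
  set f := p.coeff 0
  have hf : ∀ z, a 0 z = f.eval z := by
    intro z
    rw [← eval_slice ha, ← Polynomial.coeff_zero_eq_eval_zero]
    simp [f]
  have hf0 : f.eval 0 = 0 := by
    have := hs 0 0
    rw [← hf]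
    linear_combination (1 / 2 : k) * this
  -- The equation at `y = 0`: away from `l x = 0`, the values on the axis determine `a`. Its
  -- derivative at `x = 0` is the Euler equation below.
  have h1 : ∀ x z, l * x * a x z = (l' * x - z) * f.eval z - (l * x - z) * f.eval (x + z) := by
    intro x z
    have := h x 0 z
    rw [hf, hf, add_zero] at this
    linear_combination this
  have hode : ∀ z, z * f.derivative.eval z = (2 * l - l') * f.eval z := by
    intro z
    have hp : Polynomial.C l * Polynomial.X * p.map (Polynomial.evalRingHom z) -
        (Polynomial.C l' * Polynomial.X - Polynomial.C z) * Polynomial.C (f.eval z) +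
        (Polynomial.C l * Polynomial.X - Polynomial.C z) *
          f.comp (Polynomial.X + Polynomial.C z) = 0 := by
      refine Polynomial.funext fun x => ?_
      simp only [Polynomial.eval_sub, Polynomial.eval_mul, Polynomial.eval_X,
        Polynomial.eval_comp, Polynomial.eval_add, Polynomial.eval_C, eval_slice ha,
        Polynomial.eval_zero]
      linear_combination h1 x z
    have := congrArg (fun q => q.derivative.eval 0) hp
    simp only [Polynomial.derivative_sub, Polynomial.derivative_add, Polynomial.derivative_mul,
      Polynomial.derivative_X, Polynomial.derivative_C, Polynomial.derivative_comp,
      Polynomial.eval_sub, Polynomial.eval_mul, Polynomial.eval_X, eval_slice ha, hf,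
      Polynomial.eval_comp, Polynomial.eval_add, Polynomial.eval_C,
      Polynomial.eval_zero, Polynomial.eval_one, zero_add, Polynomial.derivative_zero] at this
    linear_combination -this
  by_cases hfz : f = 0
  · have hl : l = 0 := by
      by_contra hl
      obtain ⟨y, z, hyz⟩ := hne
      have h2 := h1 y z
      rw [hfz] at h2 hf
      rcases eq_or_ne y 0 with rfl | hy
      · exact hyz (by simp [hf])
      · simp only [Polynomial.eval_zero, mul_zero, sub_zero] at h2
        exact (mul_ne_zero (mul_ne_zero hl hy) hyz) h2
    subst hl
    rcases solution_axes_zero (l' := l') ha hs (fun x y z => by linear_combination h x y z)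
      (by simp [hf, hfz]) with h2 | ⟨h2, h3⟩
    · obtain ⟨y, z, hyz⟩ := hne
      exact absurd (h2 y z) hyz
    · exact Or.inr (Or.inl ⟨rfl, h2, h3⟩)
  obtain ⟨N, w, hw, hN, hfw⟩ := euler_ode hfz hode
  have hN0 : N ≠ 0 := by
    rintro rfl
    rw [hfw, pow_zero, mul_one] at hf0
    exact hw hf0
  have hl' : l' = 2 * l - N := by linear_combination -hN
  by_cases hl : l = 0
  · have hN1 : N = 1 := by
      have h2 := h1 1 1
      have h3 : (1 + N : k) = 2 ^ N := by
        refine mul_left_cancel₀ hw ?_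
        rw [hl, hfw, hfw, one_add_one_eq_two, one_pow, hl', hl] at h2
        linear_combination h2
      have h4 : 1 + N = 2 ^ N := by exact_mod_cast h3
      by_contra h5
      exact (one_add_lt_two_pow N (by omega)).ne h4
    subst hN1
    left
    refine ⟨by simpa using hl', w, fun y z => ?_⟩
    subst hl
    -- For `l = 0` the axis no longer determines `a`. Subtracting the known solution `w (z - y)`
    -- leaves one that vanishes on the axis; the exceptional value `l' = -3` is excluded because
    -- here `l' = -1`.
    rcases solution_axes_zero (l' := l')
      (p := p - Polynomial.C (Polynomial.C w) * (Polynomial.C Polynomial.X - Polynomial.X))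
      (a := fun y z => a y z - w * (z - y)) (fun y z => by
        rw [← ha]; simp [Polynomial.evalEval]) (fun y z => by linear_combination hs y z)
      (fun x y z => by
        rw [hl']
        rw [hl'] at h
        push_cast at h ⊢
        linear_combination h x y z) (fun z => by simp [hf, hfw]) with h2 | ⟨h2, -⟩
    · linear_combination h2 y z
    · exfalso
      rw [hl'] at h2
      have : (2 : k) = 0 := by linear_combination h2
      exact two_ne_zero this
  have h2 : N ≤ 1 ∨ (N = 2 ∧ l = 1 / 2) ∨ (N = 3 ∧ l = 2 / 3) := by
    -- Substituting `h1` at `(x, 1)` and `(1, x)` into `a(x, 1) = -a(1, x)` eliminates `a`.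
    refine exponent_le_three hl' fun x => ?_
    refine mul_left_cancel₀ hw ?_
    have e1 := h1 x 1
    have e2 := h1 1 x
    have e3 := hs x 1
    simp only [hfw, one_pow] at e1 e2
    rw [add_comm 1 x] at e2
    rw [pow_succ]
    linear_combination -e1 - x * e2 + l * x * e3
  -- A candidate satisfying `h1` agrees with `a` where `x ≠ 0`; the axis needs its own check because
  -- the factor `l x` cannot be cancelled there.
  have hax : ∀ F : k → k → k, (∀ z, F 0 z = w * z ^ N) → (∀ x z, l * x * F x z =
      w * ((l' * x - z) * z ^ N - (l * x - z) * (x + z) ^ N)) → ∀ x z, a x z = F x z := by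
    intro F hF0 hF x z
    rcases eq_or_ne x 0 with rfl | hx
    · rw [hf, hfw, hF0]
    · refine mul_left_cancel₀ (mul_ne_zero hl hx) ?_
      rw [hF, h1, hfw, hfw]
      ring
  rcases h2 with h2 | ⟨rfl, h2⟩ | ⟨rfl, h2⟩
  · obtain rfl : N = 1 := by omega
    left
    push_cast at hl'
    refine ⟨hl', w, hax _ (fun z => by ring) fun x z => ?_⟩
    rw [hl']
    ring
  · right; right; left
    push_cast at hl'
    refine ⟨h2, by rw [hl', h2]; norm_num, w, hax _ (fun z => by ring) fun x z => ?_⟩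
    rw [hl', h2]
    ring
  · right; right; right
    push_cast at hl'
    refine ⟨h2, by rw [hl', h2]; norm_num, w, hax _ (fun z => by ring) fun x z => ?_⟩
    rw [hl', h2]
    ring

/-- Solutions of the multiplicative equation do not depend on the second variable. -/
lemma exists_eval_of_mul_eq {p q : k[X][X]} {b : k → k → k}
    (hp : ∀ y z, p.evalEval z y = b y z) (hq : ∀ y z, q.evalEval y z = b y z)
    (h : ∀ x y z, b y z * b x (y + z) = b x z * b y (x + z)) :
    ∃ v : k[X], ∀ x z, b x z = v.eval x := by
  rcases eq_or_ne p 0 with rfl | hp0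
  · exact ⟨0, fun x z => by simp [← hp]⟩
  have hq0 : q ≠ 0 := by
    rintro rfl
    apply hp0
    ext1 n
    refine Polynomial.funext fun z => ?_
    have : p.map (Polynomial.evalRingHom z) = 0 :=
      Polynomial.funext fun y => by rw [eval_slice hp, ← hq]; simp
    simpa using congrArg (Polynomial.coeff · n) this
  obtain ⟨z, hz⟩ : ∃ z, p.leadingCoeff.eval z ≠ 0 := by
    by_contra! hc
    exact hp0 (Polynomial.leadingCoeff_eq_zero.1 (Polynomial.funext fun z => by simpa using hc z))
  obtain ⟨y, hy⟩ : ∃ y, q.leadingCoeff.eval y ≠ 0 := by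
    by_contra! hc
    exact hq0 (Polynomial.leadingCoeff_eq_zero.1 (Polynomial.funext fun z => by simpa using hc z))
  -- As polynomials in `x`, the left side has degree at most the first partial degree of `b`. For
  -- this `y` and `z`, where no leading coefficient drops, the right side has degree the sum of both
  -- partial degrees. Hence the second partial degree is zero.
  have hpoly : Polynomial.C (b y z) * p.map (Polynomial.evalRingHom (y + z)) =
      p.map (Polynomial.evalRingHom z) *
        (q.map (Polynomial.evalRingHom y)).comp (Polynomial.X + Polynomial.C z) := by
    refine Polynomial.funext fun x => ?_
    simp only [Polynomial.eval_mul, Polynomial.eval_C, Polynomial.eval_comp, Polynomial.eval_add,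
      Polynomial.eval_X, eval_slice hp, eval_slice (a := fun z y => b y z) (fun z y => hq y z)]
    exact h x y z
  have hdp : (p.map (Polynomial.evalRingHom z)).natDegree = p.natDegree :=
    Polynomial.natDegree_map_of_leadingCoeff_ne_zero _ hz
  have hdq : (q.map (Polynomial.evalRingHom y)).natDegree = q.natDegree :=
    Polynomial.natDegree_map_of_leadingCoeff_ne_zero _ hy
  have hpz : p.map (Polynomial.evalRingHom z) ≠ 0 :=
    fun h0 => hz (by
      simpa [Polynomial.coeff_natDegree] using congrArg (Polynomial.coeff · p.natDegree) h0)
  have hqz : (q.map (Polynomial.evalRingHom y)).comp (Polynomial.X + Polynomial.C z) ≠ 0 := by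
    rw [Ne, Polynomial.comp_X_add_C_eq_zero_iff]
    exact fun h0 => hy (by
      simpa [Polynomial.coeff_natDegree] using congrArg (Polynomial.coeff · q.natDegree) h0)
  have hdeg := congrArg Polynomial.natDegree hpoly
  rw [Polynomial.natDegree_mul hpz hqz, Polynomial.natDegree_comp, hdp, hdq,
    Polynomial.natDegree_X_add_C, mul_one] at hdeg
  have hle : (Polynomial.C (b y z) * p.map (Polynomial.evalRingHom (y + z))).natDegree ≤
      p.natDegree :=
    (Polynomial.natDegree_C_mul_le _ _).trans Polynomial.natDegree_map_le
  have hq1 : q.natDegree = 0 := by omega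
  refine ⟨q.coeff 0, fun x z => ?_⟩
  rw [← hq, Polynomial.eq_C_of_natDegree_eq_zero hq1]
  simp [Polynomial.evalEval]

/-- The solutions `η` of the equations `IsCompatible.j012` and `IsCompatible.j112` are constant. -/
lemma eta_constant {p q : k[X][X]} {b : k → k → k} {l₁ l₂ c₁ c₂ : k}
    (hp : ∀ y z, p.evalEval z y = b y z) (hq : ∀ y z, q.evalEval y z = b y z)
    (hmul : ∀ x y z, b y z * b x (y + z) = b x z * b y (x + z))
    (h : ∀ x y z, (l₁ * x - y + c₁) * b (x + y) z + (l₂ * x - z + c₂) * b y (x + z) =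
      (l₂ * x - y - z + c₂) * b y z) :
    ∃ w, (∀ y z, b y z = w) ∧ w * l₁ = 0 ∧ w * c₁ = 0 := by
  obtain ⟨v, hv⟩ := exists_eval_of_mul_eq hp hq hmul
  have h1 : ∀ x y, (l₁ * x - y + c₁) * v.eval (x + y) = -y * v.eval y := by
    intro x y
    have := h x y 0
    simp only [hv] at this
    linear_combination this
  by_cases hv0 : v = 0
  · exact ⟨0, fun y z => by simp [hv, hv0], by simp, by simp⟩
  have h2 : (Polynomial.C l₁ * Polynomial.X + Polynomial.C c₁) * v = 0 := by
    refine Polynomial.funext fun x => ?_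
    simpa using h1 x 0
  have h3 := (mul_eq_zero.1 h2).resolve_right hv0
  have hl : l₁ = 0 := by simpa using congrArg (Polynomial.coeff · 1) h3
  have hc : c₁ = 0 := by simpa using congrArg (Polynomial.coeff · 0) h3
  -- With `l₁ = c₁ = 0` the relation `h1` is `y v(x + y) = y v(y)`; at `y = 1` it makes `v`
  -- constant.
  refine ⟨v.eval 1, fun y z => ?_, by simp [hl], by simp [hc]⟩
  have := h1 (y - 1) 1
  rw [hl, hc, sub_add_cancel] at this
  rw [hv]
  linear_combination -this

end FunctionalEquations

/-! ### Sesquilinearity and pseudobrackets determined on a basis -/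

section Sesquilinear

variable {k : Type*} [Field k] {L : Type*} [AddCommGroup L] [Module k[X] L]

lemma t2_mul (f g f' g' : k[X]) : t2 f g * t2 f' g' = t2 (f * f') (g * g') :=
  Algebra.TensorProduct.tmul_mul_tmul _ _ _ _

lemma t2_add_left (f f' g : k[X]) : t2 (f + f') g = t2 f g + t2 f' g :=
  TensorProduct.add_tmul _ _ _

lemma t2_add_right (f g g' : k[X]) : t2 f (g + g') = t2 f g + t2 f g' :=
  TensorProduct.tmul_add _ _ _

variable (ρ : PseudoBracket k L)

lemma PseudoBracket.leftComp_tmul (c : L) (F : H2 k) (a : L) :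
    ρ.leftComp c (F ⊗ₜ a) =
      inl12 k F • LinearMap.rTensor L (comulLeft k).toLinearMap (ρ.toFun a c) := rfl

lemma PseudoBracket.rightComp_tmul (a : L) (F : H2 k) (b : L) :
    ρ.rightComp a (F ⊗ₜ b) =
      inr23 k F • LinearMap.rTensor L (comulRight k).toLinearMap (ρ.toFun a b) := rfl

lemma PseudoBracket.leftComp_smul (c : L) (F : H2 k) (x : H2 k ⊗[k[X]] L) :
    ρ.leftComp c (F • x) = inl12 k F • ρ.leftComp c x := by
  induction x using TensorProduct.induction_on with
  | zero => simp
  | tmul G a => rw [TensorProduct.smul_tmul', smul_eq_mul, leftComp_tmul, leftComp_tmul, map_mul,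
      mul_smul]
  | add x y hx hy => rw [smul_add, map_add, map_add, smul_add, hx, hy]

lemma PseudoBracket.rightComp_smul (a : L) (F : H2 k) (x : H2 k ⊗[k[X]] L) :
    ρ.rightComp a (F • x) = inr23 k F • ρ.rightComp a x := by
  induction x using TensorProduct.induction_on with
  | zero => simp
  | tmul G a => rw [TensorProduct.smul_tmul', smul_eq_mul, rightComp_tmul, rightComp_tmul, map_mul,
      mul_smul]
  | add x y hx hy => rw [smul_add, map_add, map_add, smul_add, hx, hy]

lemma PseudoBracket.leftComp_smul_arg (h : k[X]) (c : L) (x : H2 k ⊗[k[X]] L) :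
    ρ.leftComp (h • c) x = t3 1 1 h • ρ.leftComp c x := by
  induction x using TensorProduct.induction_on with
  | zero => simp
  | tmul G a =>
    have h1 : ρ.toFun a (h • c) = t2 1 h • ρ.toFun a c := by simpa using ρ.map_smul 1 h a c
    rw [leftComp_tmul, leftComp_tmul, h1, rTensor_smul, smul_smul, smul_smul, mul_comm]
    congr 2
    exact comulLeft_one_t2 h
  | add x y hx hy => rw [map_add, map_add, smul_add, hx, hy]

lemma PseudoBracket.rightComp_smul_arg (h : k[X]) (a : L) (x : H2 k ⊗[k[X]] L) :
    ρ.rightComp (h • a) x = t3 h 1 1 • ρ.rightComp a x := by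
  induction x using TensorProduct.induction_on with
  | zero => simp
  | tmul G b =>
    have h1 : ρ.toFun (h • a) b = t2 h 1 • ρ.toFun a b := by simpa using ρ.map_smul h 1 a b
    rw [rightComp_tmul, rightComp_tmul, h1, rTensor_smul, smul_smul, smul_smul, mul_comm]
    congr 2
    exact comulRight_t2_one h
  | add x y hx hy => rw [map_add, map_add, smul_add, hx, hy]

lemma PseudoBracket.leftComp_add_arg (c c' : L) (x : H2 k ⊗[k[X]] L) :
    ρ.leftComp (c + c') x = ρ.leftComp c x + ρ.leftComp c' x := by
  induction x using TensorProduct.induction_on with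
  | zero => simp
  | tmul G a => simp only [leftComp_tmul, map_add, smul_add]
  | add x y hx hy => rw [map_add, map_add, map_add, hx, hy]; abel

lemma PseudoBracket.rightComp_add_arg (a a' : L) (x : H2 k ⊗[k[X]] L) :
    ρ.rightComp (a + a') x = ρ.rightComp a x + ρ.rightComp a' x := by
  induction x using TensorProduct.induction_on with
  | zero => simp
  | tmul G b => simp only [rightComp_tmul, map_add, AddMonoidHom.add_apply, smul_add]
  | add x y hx hy => rw [map_add, map_add, map_add, hx, hy]; abel

lemma PseudoBracket.leftComp_zero_arg (x : H2 k ⊗[k[X]] L) : ρ.leftComp 0 x = 0 := by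
  simpa using ρ.leftComp_add_arg 0 0 x

lemma PseudoBracket.rightComp_zero_arg (x : H2 k ⊗[k[X]] L) : ρ.rightComp 0 x = 0 := by
  simpa using ρ.rightComp_add_arg 0 0 x

lemma PseudoBracket.smul_left (f : k[X]) (a b : L) :
    ρ.toFun (f • a) b = t2 f 1 • ρ.toFun a b := by simpa using ρ.map_smul f 1 a b

lemma PseudoBracket.smul_right (f : k[X]) (a b : L) :
    ρ.toFun a (f • b) = t2 1 f • ρ.toFun a b := by simpa using ρ.map_smul 1 f a b

lemma basis_induction {ι : Type*} (e : Module.Basis ι k[X] L) {P : L → Prop} (h0 : P 0)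
    (hadd : ∀ x y, P x → P y → P (x + y))
    (hsmul : ∀ (f : k[X]) x, P x → P (f • x)) (he : ∀ i, P (e i)) (x : L) : P x := by
  refine Submodule.span_induction (p := fun x _ => P x) ?_ h0 (fun x y _ _ => hadd x y)
    (fun f x _ => hsmul f x) (e.mem_span x)
  rintro _ ⟨i, rfl⟩
  exact he i

variable {ι : Type*} (e : Module.Basis ι k[X] L)

/-- The Lie axioms need to be checked only on a basis. -/
lemma PseudoBracket.isLie_of_basis
    (hskew : ∀ i j, ρ.toFun (e i) (e j) =
      -LinearMap.rTensor L (flip k).toLinearMap (ρ.toFun (e j) (e i)))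
    (hjac : ∀ i j l, ρ.leftComp (e l) (ρ.toFun (e i) (e j)) =
      ρ.rightComp (e i) (ρ.toFun (e j) (e l)) -
        LinearMap.rTensor L (flip12 k).toLinearMap (ρ.rightComp (e j) (ρ.toFun (e i) (e l)))) :
    ρ.IsLie where
  skew a b := by
    refine basis_induction e (P := fun a => ρ.toFun a b =
      -LinearMap.rTensor L (flip k).toLinearMap (ρ.toFun b a)) (by simp) ?_ ?_ (fun i => ?_) a
    · intro x y hx hy
      rw [map_add, AddMonoidHom.add_apply, hx, hy, map_add, map_add, neg_add]
    -- The scalar acts as `f ⊗ 1` on one side and as `1 ⊗ f` on the other; the flip exchanges the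
    -- two.
    · intro f x hx
      rw [ρ.smul_left, ρ.smul_right, hx, rTensor_smul, smul_neg]
      rfl
    refine basis_induction e (P := fun b => ρ.toFun (e i) b =
      -LinearMap.rTensor L (flip k).toLinearMap (ρ.toFun b (e i))) (by simp) ?_ ?_ (hskew i) b
    · intro x y hx hy
      rw [map_add, map_add, AddMonoidHom.add_apply, hx, hy, map_add, neg_add]
    · intro f x hx
      rw [ρ.smul_left, ρ.smul_right, hx, rTensor_smul, smul_neg]
      rfl
  jacobi a b c := by
    have hf1 : ∀ f : k[X], flip12 k (t3 f 1 1) = t3 1 f 1 := fun f => rfl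
    have hf2 : ∀ f : k[X], flip12 k (t3 1 f 1) = t3 f 1 1 := fun f => rfl
    have hf3 : ∀ f : k[X], flip12 k (t3 1 1 f) = t3 1 1 f := fun f => rfl
    refine basis_induction e (P := fun a => ρ.leftComp c (ρ.toFun a b) =
      ρ.rightComp a (ρ.toFun b c) -
        LinearMap.rTensor L (flip12 k).toLinearMap (ρ.rightComp b (ρ.toFun a c)))
      (by simp [ρ.rightComp_zero_arg]) ?_ ?_ (fun i => ?_) a
    · intro x y hx hy
      simp only [map_add, AddMonoidHom.add_apply, ρ.rightComp_add_arg, hx, hy]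
      abel
    · intro f x hx
      rw [ρ.smul_left, ρ.smul_left, ρ.leftComp_smul, ρ.rightComp_smul, ρ.rightComp_smul_arg,
        rTensor_smul, hx, inl12_t2, inr23_t2, hf2, smul_sub]
    refine basis_induction e (P := fun b => ρ.leftComp c (ρ.toFun (e i) b) =
      ρ.rightComp (e i) (ρ.toFun b c) -
        LinearMap.rTensor L (flip12 k).toLinearMap (ρ.rightComp b (ρ.toFun (e i) c)))
      (by simp [ρ.rightComp_zero_arg]) ?_ ?_ (fun j => ?_) b
    · intro x y hx hy
      simp only [map_add, AddMonoidHom.add_apply, ρ.rightComp_add_arg, hx, hy]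
      abel
    · intro f x hx
      rw [ρ.smul_left, ρ.smul_right, ρ.leftComp_smul, ρ.rightComp_smul, ρ.rightComp_smul_arg,
        rTensor_smul, hx, inl12_t2, inr23_t2, hf1, smul_sub]
    refine basis_induction e (P := fun c => ρ.leftComp c (ρ.toFun (e i) (e j)) =
      ρ.rightComp (e i) (ρ.toFun (e j) c) -
        LinearMap.rTensor L (flip12 k).toLinearMap (ρ.rightComp (e j) (ρ.toFun (e i) c)))
      (by simp [ρ.leftComp_zero_arg]) ?_ ?_ (fun l => hjac i j l) c
    · intro x y hx hy
      simp only [map_add, ρ.leftComp_add_arg, hx, hy]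
      abel
    · intro f x hx
      rw [ρ.smul_right, ρ.smul_right, ρ.leftComp_smul_arg, ρ.rightComp_smul, ρ.rightComp_smul,
        rTensor_smul, hx, inr23_t2, hf3, smul_sub]

/-- The pseudobracket with prescribed values on a basis. -/
def PseudoBracket.ofBasis [Fintype ι] (Q : ι → ι → H2 k ⊗[k[X]] L) : PseudoBracket k L where
  toFun := AddMonoidHom.mk' (fun a => AddMonoidHom.mk'
      (fun b => ∑ i, ∑ j, t2 (e.repr a i) (e.repr b j) • Q i j)
      (fun b b' => by
        simp only [map_add, Finsupp.add_apply, t2_add_right, add_smul, Finset.sum_add_distrib]))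
    (fun a a' => by
      ext b
      simp only [AddMonoidHom.mk'_apply, AddMonoidHom.add_apply, map_add, Finsupp.add_apply,
        t2_add_left, add_smul, Finset.sum_add_distrib])
  map_smul f g a b := by
    simp only [AddMonoidHom.mk'_apply, _root_.map_smul, Finsupp.smul_apply, smul_eq_mul,
      Finset.smul_sum, smul_smul, t2_mul]

lemma PseudoBracket.ofBasis_apply [Fintype ι] (Q : ι → ι → H2 k ⊗[k[X]] L) (i j : ι) :
    (PseudoBracket.ofBasis e Q).toFun (e i) (e j) = Q i j := by
  classical
  change ∑ i', ∑ j', t2 (e.repr (e i) i') (e.repr (e j) j') • Q i' j' = Q i j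
  rw [Finset.sum_eq_single i, Finset.sum_eq_single j]
  · simp only [Module.Basis.repr_self, Finsupp.single_eq_same]
    exact one_smul (H2 k) _
  · intro j' _ hj
    have : t2 (e.repr (e i) i) (e.repr (e j) j') = 0 := by
      rw [e.repr_self, e.repr_self, Finsupp.single_eq_of_ne hj]
      exact TensorProduct.tmul_zero _ _
    rw [this, zero_smul]
  · simp
  · intro i' _ hi
    refine Finset.sum_eq_zero fun j' _ => ?_
    have : t2 (e.repr (e i) i') (e.repr (e j) j') = 0 := by
      rw [e.repr_self, Finsupp.single_eq_of_ne hi]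
      exact TensorProduct.zero_tmul _ _
    rw [this, zero_smul]
  · simp

/-- Base change of a free module is free on the same basis, so the coefficients can be compared. -/
lemma tmul_basis_injective {A : Type*} [CommRing A] [Algebra k[X] A] (i : ι) {F G : A}
    (h : F ⊗ₜ[k[X]] e i = G ⊗ₜ[k[X]] e i) : F = G := by
  have := congrArg (fun x => (Algebra.TensorProduct.basis A e).repr x i) h
  simpa using this

end Sesquilinear

/-! ### The Jacobi identity as a system of functional equations -/

section Reduction

variable {k : Type*} [Field k]

lemma ev2_alpha (x y : k) : ev2 x y (alpha k) = x - y := by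
  simp [alpha, ev2_d]

lemma ev2_beta (l c x y : k) : ev2 x y (beta l c) = l * x - y + c := by
  simp [beta, ev2_d]

/-- The functional equations for `α'` and `η` that express the Jacobi identity when all `ηᵢⱼ`
vanish. -/
structure IsCompatible (T : Table k) : Prop where
  skew : ∀ x y : k, ev2 x y T.alpha' = -ev2 y x T.alpha'
  j011 : ∀ x y z : k, (T.lam1 * x - y + T.kap1) * ev2 (x + y) z T.alpha' =
    (T.lam2 * x - (y + z) + T.kap2) * ev2 y z T.alpha'
      - (T.lam1 * x - z + T.kap1) * ev2 y (x + z) T.alpha'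
  j012 : ∀ x y z : k, (T.lam1 * x - y + T.kap1) * ev2 (x + y) z T.eta =
    (T.lam2 * x - (y + z) + T.kap2) * ev2 y z T.eta
      - (T.lam2 * x - z + T.kap2) * ev2 y (x + z) T.eta
  j111 : ∀ x y z : k, -(ev2 x y T.alpha' * ev2 z (x + y) T.eta) =
    ev2 y z T.alpha' * ev2 x (y + z) T.eta - ev2 x z T.alpha' * ev2 y (x + z) T.eta
  j112 : ∀ x y z : k, ev2 y z T.eta * ev2 x (y + z) T.eta = ev2 x z T.eta * ev2 y (x + z) T.eta

variable {L : Type*} [AddCommGroup L] [Module k[X] L] {e : Module.Basis (Fin 4) k[X] L}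
  {m : ℕ} {T : Table k}

lemma PseudoBracket.IsLie.swap {ρ : PseudoBracket k L} (h : ρ.IsLie) {a b c : L} {F : H2 k}
    (hF : ρ.toFun a b = F ⊗ₜ c) : ρ.toFun b a = (-flip k F) ⊗ₜ c := by
  rw [h.skew, hF, LinearMap.rTensor_tmul, TensorProduct.neg_tmul]
  rfl

/-- The Jacobi identity for elements whose brackets are multiples of a basis element. -/
lemma PseudoBracket.IsLie.jacobi_eval {ρ : PseudoBracket k L} (h : ρ.IsLie) {a b c r s t : L}
    {i : Fin 4} {F G F₁ G₁ F₂ G₂ : H2 k} (h1 : ρ.toFun a b = F ⊗ₜ r)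
    (h2 : ρ.toFun r c = G ⊗ₜ e i) (h3 : ρ.toFun b c = F₁ ⊗ₜ s)
    (h4 : ρ.toFun a s = G₁ ⊗ₜ e i) (h5 : ρ.toFun a c = F₂ ⊗ₜ t)
    (h6 : ρ.toFun b t = G₂ ⊗ₜ e i) (x y z : k) :
    ev2 x y F * ev2 (x + y) z G = ev2 y z F₁ * ev2 x (y + z) G₁ -
      ev2 x z F₂ * ev2 y (x + z) G₂ := by
  have := h.jacobi a b c
  rw [h1, h3, h5, ρ.leftComp_tmul, ρ.rightComp_tmul, ρ.rightComp_tmul, h2, h4, h6,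
    LinearMap.rTensor_tmul, LinearMap.rTensor_tmul, LinearMap.rTensor_tmul,
    TensorProduct.smul_tmul', TensorProduct.smul_tmul', TensorProduct.smul_tmul',
    LinearMap.rTensor_tmul, ← TensorProduct.sub_tmul] at this
  have := congrArg (ev3 x y z) (tmul_basis_injective e i this)
  simpa [ev3_flip12, ev3_inl12, ev3_inr23, ev3_comulLeft, ev3_comulRight] using this

lemma IsSchrodingerVirasoro.isCompatible {ρ : PseudoBracket k L}
    (h : IsSchrodingerVirasoro e ρ m T) : IsCompatible T where
  skew x y := by
    have h1 := h.isLie.swap h.b11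
    rw [h.b11] at h1
    have := congrArg (ev2 x y) (tmul_basis_injective e 2 h1)
    simpa [ev2_flip] using this
  j011 x y z := by
    have := h.isLie.jacobi_eval h.b01 h.b11 h.b11 h.b02 h.b01 h.b11 x y z
    rw [ev2_beta, ev2_beta, ev2_beta] at this
    linear_combination this
  j012 x y z := by
    have := h.isLie.jacobi_eval h.b01 h.b12 h.b12 h.b02 h.b02 h.b12 x y z
    rw [ev2_beta, ev2_beta, ev2_beta] at this
    linear_combination this
  j111 x y z := by
    -- The left side involves `[e₂, e₁]`, which skewness expresses through the flip of `η`; hence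
    -- the sign and the exchanged arguments in `j111`.
    have := h.isLie.jacobi_eval h.b11 (h.isLie.swap h.b12) h.b11 h.b12 h.b11 h.b12 x y z
    rw [map_neg, ev2_flip] at this
    linear_combination this
  j112 x y z := by
    have h22 : ρ.toFun (e 2) (e 2) = (0 : H2 k) ⊗ₜ e 2 := by rw [h.b22, TensorProduct.zero_tmul]
    have := h.isLie.jacobi_eval h.b11 h22 h.b12 h.b12 h.b12 h.b12 x y z
    rw [map_zero] at this
    linear_combination -this

/-- The coefficients of the brackets of the basis elements, for `ηᵢⱼ = 0`. -/
def bracketCoeff (T : Table k) : Fin 4 → Fin 4 → H2 k :=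
  ![![alpha k, beta T.lam1 T.kap1, beta T.lam2 T.kap2, beta T.lam3 T.kap3],
    ![-flip k (beta T.lam1 T.kap1), T.alpha', T.eta, 0],
    ![-flip k (beta T.lam2 T.kap2), -flip k T.eta, 0, 0],
    ![-flip k (beta T.lam3 T.kap3), 0, 0, 0]]

/-- The index of the basis element of which the bracket of two basis elements is a multiple. Where
the bracket vanishes it is chosen to make the operation associative. -/
def bracketIndex : Fin 4 → Fin 4 → Fin 4 :=
  ![![0, 1, 2, 3], ![1, 2, 2, 3], ![2, 2, 2, 3], ![3, 3, 3, 3]]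

-- Triples that differ by a permutation give the same equation with permuted variables, up to sign
-- and skewness of `α'`. So every triple is either automatic or an instance of one of the four
-- Jacobi equations of `IsCompatible`.
set_option maxHeartbeats 1000000 in
lemma IsCompatible.jacobi_bracketCoeff (h : IsCompatible T) (i j l : Fin 4) (x y z : k) :
    ev2 x y (bracketCoeff T i j) * ev2 (x + y) z (bracketCoeff T (bracketIndex i j) l) =
      ev2 y z (bracketCoeff T j l) * ev2 x (y + z) (bracketCoeff T i (bracketIndex j l)) -
        ev2 x z (bracketCoeff T i l) * ev2 y (x + z) (bracketCoeff T j (bracketIndex i l)) := by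
  have e1 := add_comm y x
  have e2 := add_comm z x
  have e3 := add_comm z y
  have s := h.skew (x + z) y
  have a1 := h.j011 x y z
  have a2 := h.j011 y x z
  have a3 := h.j011 z x y
  have b1 := h.j012 x y z
  have b2 := h.j012 x z y
  have b3 := h.j012 y x z
  have b4 := h.j012 z x y
  have b5 := h.j012 y z x
  have b6 := h.j012 z y x
  have c1 := h.j111 x y z
  have d1 := h.j112 x y z
  have d2 := h.j112 x z y
  have d3 := h.j112 y z x
  simp only [e1, e2, e3] at a1 a2 a3 b1 b2 b3 b4 b5 b6 d1 d2 d3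
  fin_cases i <;> fin_cases j <;> fin_cases l <;>
    simp [bracketCoeff, bracketIndex, ev2_flip, ev2_alpha, ev2_beta] <;>
    first
    | ring1
    | linear_combination a1
    | linear_combination -a2
    | linear_combination a3 - (T.lam1 * z - x + T.kap1) * s
    | linear_combination b1
    | linear_combination -b2
    | linear_combination -b3
    | linear_combination b4
    | linear_combination b5
    | linear_combination -b6
    | linear_combination c1
    | linear_combination -d1
    | linear_combination d1
    | linear_combination d2
    | linear_combination -d2
    | linear_combination d3
    | linear_combination -d3

variable [Infinite k]

lemma IsCompatible.exists_bracket (h : IsCompatible T) (hm : IsMType m T.alpha')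
    (h11 : T.eta11 = 0) (h12 : T.eta12 = 0) (h21 : T.eta21 = 0) (h22 : T.eta22 = 0) :
    ∃ ρ : PseudoBracket k L, IsSchrodingerVirasoro e ρ m T := by
  set ρ := PseudoBracket.ofBasis e fun i j => bracketCoeff T i j ⊗ₜ[k[X]] e (bracketIndex i j)
  have hρ : ∀ i j, ρ.toFun (e i) (e j) = bracketCoeff T i j ⊗ₜ[k[X]] e (bracketIndex i j) :=
    PseudoBracket.ofBasis_apply e _
  have hskew : ∀ i j, bracketCoeff T i j = -flip k (bracketCoeff T j i) := by
    intro i j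
    refine H2_ext fun x y => ?_
    have := h.skew x y
    fin_cases i <;> fin_cases j <;> simp [bracketCoeff, ev2_flip, ev2_alpha, this]
  -- All three terms of a Jacobi identity become multiples of one and the same basis element, so
  -- only their coefficients must be compared.
  have hidx_left : ∀ i j l, bracketIndex (bracketIndex i j) l =
      bracketIndex i (bracketIndex j l) := by decide
  have hidx_right : ∀ i j l, bracketIndex j (bracketIndex i l) =
      bracketIndex i (bracketIndex j l) := by decide
  have hidx : ∀ i j, bracketIndex i j = bracketIndex j i := by decide
  refine ⟨ρ, ρ.isLie_of_basis e (fun i j => ?_) fun i j l => ?_, hm, hρ 0 0, hρ 0 1, hρ 0 2,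
    hρ 0 3, hρ 1 1, hρ 1 2, ?_, ?_, ?_, ?_⟩
  · rw [hρ, hρ, hskew, hidx, LinearMap.rTensor_tmul, TensorProduct.neg_tmul]
    rfl
  · rw [hρ, hρ, hρ, ρ.leftComp_tmul, ρ.rightComp_tmul, ρ.rightComp_tmul, hρ, hρ, hρ,
      LinearMap.rTensor_tmul, LinearMap.rTensor_tmul, LinearMap.rTensor_tmul,
      TensorProduct.smul_tmul', TensorProduct.smul_tmul', TensorProduct.smul_tmul',
      LinearMap.rTensor_tmul]
    rw [hidx_left i j l, hidx_right i j l, ← TensorProduct.sub_tmul]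
    congr 1
    refine H3_ext fun x y z => ?_
    rw [map_sub]
    change _ = _ - ev3 x y z (flip12 k _)
    rw [ev3_flip12]
    simp only [smul_eq_mul, map_mul, ev3_inl12, ev3_inr23]
    exact (congrArg _ (ev3_comulLeft _ _ _ _)).trans ((h.jacobi_bracketCoeff i j l x y z).trans
      (congrArg₂ _ (congrArg _ (ev3_comulRight _ _ _ _)) (congrArg _ (ev3_comulRight _ _ _ _))).symm)
  · rw [h11, h12]
    simpa [bracketCoeff] using hρ 1 3
  · rw [h21, h22]
    simpa [bracketCoeff] using hρ 2 3
  · simpa [bracketCoeff] using hρ 2 2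
  · simpa [bracketCoeff] using hρ 3 3

end Reduction

/-! ### The families (Z1)–(Z5) -/

section Classification

variable {k : Type*} [Field k]

lemma evalEval_ev2 (u v : k[X][X]) (F : H2 k) (y z : k) :
    (ev2 u v F).evalEval z y = ev2 (u.evalEval z y) (v.evalEval z y) F := by
  let φ : k[X][X] →ₐ[k] k :=
    { Polynomial.evalEvalRingHom z y with
      commutes' := fun r => by simp [Polynomial.algebraMap_apply] }
  exact map_ev2 φ u v F

lemma ev2_smul_d_zero (a x y : k) : ev2 x y (a • d k 0 0) = a := by
  simp [ev2_d]

variable {T : Table k}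

lemma isMType_one {w : k} (hw : w ≠ 0) : IsMType 1 (w • (d k 0 1 - d k 1 0)) := by
  -- On indices `0, 1` the factor `j - i` is the sign of the skew matrix.
  refine Or.inr ⟨one_pos, fun i j => w * ((j : k) - i), ?_, 0, by norm_num, Or.inl (by simpa)⟩
  simp only [Finset.sum_range_succ, Finset.sum_range_zero]
  push_cast
  module

/-- The alternative serves both families of type 2: (Z4) has `v ≠ 0`, whereas in (Z3) `v` may vanish
with `κ₁` and only `w` is certain to be nonzero. -/
lemma isMType_two (κ : k) {v w : k} (hw : v ≠ 0 ∨ w ≠ 0) :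
    IsMType 2 (v • (d k 0 2 - d k 2 0) + w • (d k 1 2 - d k 2 1) + κ • (d k 0 1 - d k 1 0)) := by
  let c : ℕ → ℕ → k := fun i j => if i = 0 ∧ j = 2 then v else if i = 1 ∧ j = 2 then w else
    if i = 0 ∧ j = 1 then κ else 0
  refine Or.inr ⟨two_pos, fun i j => c i j - c j i, ?_, ?_⟩
  · simp [c, Finset.sum_range_succ]
    module
  · rcases hw with hw | hw
    · exact ⟨0, by norm_num, Or.inl (by simpa [c])⟩
    · exact ⟨1, by norm_num, Or.inl (by simpa [c])⟩

lemma isMType_three (c₁ c₂ c₃ : k) {w : k} (hw : w ≠ 0) :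
    IsMType 3 (w • (d k 0 3 - d k 3 0) + c₁ • (d k 1 2 - d k 2 1) + c₂ • (d k 0 2 - d k 2 0)
      + c₃ • (d k 0 1 - d k 1 0)) := by
  let c : ℕ → ℕ → k := fun i j => if i = 0 ∧ j = 3 then w else if i = 1 ∧ j = 2 then c₁ else
    if i = 0 ∧ j = 2 then c₂ else if i = 0 ∧ j = 1 then c₃ else 0
  refine Or.inr ⟨three_pos, fun i j => c i j - c j i, ?_, 0, by norm_num, Or.inl (by simpa [c])⟩
  simp [c, Finset.sum_range_succ]
  module

/-- The functional equations for constant `η`. -/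
lemma isCompatible_of_eta {a : k} (hη : T.eta = a • d k 0 0) (h1 : a * T.lam1 = 0)
    (h2 : a * T.kap1 = 0) {A : k → k → k} (hA : ∀ x y, ev2 x y T.alpha' = A x y)
    (hs : ∀ x y, A x y = -A y x)
    (hj : ∀ x y z, (T.lam1 * x - y + T.kap1) * A (x + y) z =
      (T.lam2 * x - (y + z) + T.kap2) * A y z - (T.lam1 * x - z + T.kap1) * A y (x + z))
    (hc : ∀ x y z, a * (A x y + A y z - A x z) = 0) : IsCompatible T where
  skew x y := by rw [hA, hA, hs]
  j011 x y z := by rw [hA, hA, hA, hj]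
  j012 x y z := by
    simp only [hη, ev2_smul_d_zero]
    linear_combination x * h1 + h2
  j111 x y z := by
    simp only [hη, ev2_smul_d_zero, hA]
    linear_combination -hc x y z
  j112 x y z := by simp only [hη, ev2_smul_d_zero]

lemma eta_eq_zero_smul (h : T.eta = 0) : T.eta = (0 : k) • d k 0 0 := by
  rw [h, zero_smul]

lemma IsZ2.isMType (h : IsZ2 T) : IsMType 1 T.alpha' := by
  obtain ⟨⟨w, hA⟩, h0, -⟩ := h
  rw [hA] at h0 ⊢
  exact isMType_one (by rintro rfl; simp at h0)

lemma IsZ4.isMType (h : IsZ4 T) : IsMType 2 T.alpha' := by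
  obtain ⟨⟨w, hA⟩, h0, -⟩ := h
  rw [hA] at h0 ⊢
  convert isMType_two (-w * T.kap1) (v := w) (w := 0)
    (Or.inl (by rintro rfl; simp at h0)) using 1
  module

lemma IsZ1.isCompatible (h : IsZ1 T) : IsCompatible T := by
  obtain ⟨hA, a, hη, h1, h2⟩ := h
  exact isCompatible_of_eta hη h1 h2 (A := fun _ _ => 0) (fun x y => by simp [hA])
    (by simp) (by simp) (by simp)

lemma IsZ2.isCompatible (h : IsZ2 T) : IsCompatible T := by
  obtain ⟨⟨w, hA⟩, -, ⟨a, hη, h1, h2⟩, h3, h4⟩ := h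
  refine isCompatible_of_eta hη h1 h2 (A := fun x y => w * (y - x)) (fun x y => ?_)
    (fun x y => by ring) (fun x y z => ?_) (fun x y z => by ring)
  · simp [hA, ev2_d]
  · rw [h3, h4]
    ring

variable [CharZero k]

lemma IsCompatible.eta_eq (h : IsCompatible T) :
    ∃ a : k, T.eta = a • d k 0 0 ∧ a * T.lam1 = 0 ∧ a * T.kap1 = 0 := by
  obtain ⟨a, h1, h2, h3⟩ := eta_constant (p := ev2 Polynomial.X (Polynomial.C Polynomial.X) T.eta)
    (q := ev2 (Polynomial.C Polynomial.X) Polynomial.X T.eta) (b := fun y z => ev2 y z T.eta)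
    (l₁ := T.lam1) (l₂ := T.lam2) (c₁ := T.kap1) (c₂ := T.kap2)
    (fun y z => by rw [evalEval_ev2]; simp [Polynomial.evalEval])
    (fun y z => by rw [evalEval_ev2]; simp [Polynomial.evalEval])
    h.j112 (fun x y z => by linear_combination h.j012 x y z)
  exact ⟨a, H2_ext fun x y => by rw [h1, ev2_smul_d_zero], h2, h3⟩

lemma IsZ3.isMType (h : IsZ3 T) : IsMType 2 T.alpha' := by
  obtain ⟨⟨w, hA⟩, h0, -⟩ := h
  rw [hA] at h0 ⊢
  convert isMType_two (w * (T.kap1 ^ 2 / 2)) (v := -w * T.kap1) (w := w)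
    (Or.inr (by rintro rfl; simp at h0)) using 1
  module

lemma IsZ5.isMType (h : IsZ5 T) : IsMType 3 T.alpha' := by
  obtain ⟨⟨w, hA⟩, h0, -⟩ := h
  rw [hA] at h0 ⊢
  convert isMType_three (w * (1 / 2)) (-w * (3 * T.kap1 / 2)) (w * (3 / 4 * T.kap1 ^ 2)) (w := w)
    (by rintro rfl; simp at h0) using 1
  module

/-- In the variables shifted by `κ` the coefficients depending on `κ` disappear and the solution
from `skew_solutions` becomes visible; the factor `1/2` comes from the divided powers. -/
lemma ev2_Z3 (w κ x y : k) : ev2 x y (-w • (κ • (d k 0 2 - d k 2 0) - (d k 1 2 - d k 2 1)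
    - (κ ^ 2 / 2) • (d k 0 1 - d k 1 0))) = w / 2 * ((x - κ) * (y - κ) * (y - x)) := by
  simp [ev2_d]
  ring

lemma ev2_Z4 (w κ x y : k) : ev2 x y (w • ((d k 0 2 - d k 2 0) - κ • (d k 0 1 - d k 1 0))) =
    w / 2 * ((y - κ) ^ 2 - (x - κ) ^ 2) := by
  simp [ev2_d]
  ring

lemma ev2_Z5 (w κ x y : k) : ev2 x y (w • ((d k 0 3 - d k 3 0) +
    (1 / 2 : k) • (d k 1 2 - d k 2 1) - (3 * κ / 2) • (d k 0 2 - d k 2 0)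
    + (3 / 4 * κ ^ 2) • (d k 0 1 - d k 1 0))) =
    w / 6 * ((y - κ) ^ 3 + 3 / 2 * ((x - κ) * (y - κ) ^ 2) - 3 / 2 * ((x - κ) ^ 2 * (y - κ))
      - (x - κ) ^ 3) := by
  simp [ev2_d, Nat.factorial]
  ring

lemma IsZ3.isCompatible (h : IsZ3 T) : IsCompatible T := by
  obtain ⟨⟨w, hA⟩, -, hη, h1, h2, h3⟩ := h
  refine isCompatible_of_eta (eta_eq_zero_smul hη) (zero_mul _) (zero_mul _)
    (fun x y => by rw [hA, ev2_Z3]) (fun x y => by ring) (fun x y z => ?_) (fun x y z => by ring)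
  rw [h1, h2, h3]
  ring

lemma IsZ4.isCompatible (h : IsZ4 T) : IsCompatible T := by
  obtain ⟨⟨w, hA⟩, -, hη, h1, h2, h3⟩ := h
  refine isCompatible_of_eta (eta_eq_zero_smul hη) (zero_mul _) (zero_mul _)
    (fun x y => by rw [hA, ev2_Z4]) (fun x y => by ring) (fun x y z => ?_) (fun x y z => by ring)
  rw [h1, h2, h3]
  ring

lemma IsZ5.isCompatible (h : IsZ5 T) : IsCompatible T := by
  obtain ⟨⟨w, hA⟩, -, hη, h1, h2, h3⟩ := h
  refine isCompatible_of_eta (eta_eq_zero_smul hη) (zero_mul _) (zero_mul _)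
    (fun x y => by rw [hA, ev2_Z5]) (fun x y => by ring) (fun x y z => ?_) (fun x y z => by ring)
  rw [h1, h2, h3]
  ring

lemma IsCompatible.classification (h : IsCompatible T) (h0 : T.alpha' ≠ 0) :
    IsZ2 T ∨ IsZ3 T ∨ IsZ4 T ∨ IsZ5 T := by
  obtain ⟨a, hη, ha1, ha2⟩ := h.eta_eq
  obtain ⟨y₀, z₀, hne⟩ : ∃ y z : k, ev2 y z T.alpha' ≠ 0 := by
    by_contra! hc
    exact h0 (H2_ext fun x y => by rw [hc, map_zero])
  -- At `x = 0` the equation `j011` is `(κ₂ - 2κ₁) α'(y, z) = 0`.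
  have hκ : T.kap2 = 2 * T.kap1 := by
    refine mul_right_cancel₀ hne ?_
    have := h.j011 0 y₀ z₀
    rw [zero_add, zero_add] at this
    linear_combination -this
  have hback : ∀ x y : k, ev2 x y T.alpha' =
      ev2 (x - T.kap1 + T.kap1) (y - T.kap1 + T.kap1) T.alpha' := by simp
  have hη0 : a = 0 → T.eta = 0 := fun h => by rw [hη, h, zero_smul]
  -- Shifting both variables by `κ₁` absorbs `κ₁` on the left and `κ₂ = 2κ₁` on the right.
  rcases skew_solutions (l := T.lam1) (l' := T.lam2)
    (p := ev2 (Polynomial.X + Polynomial.C (Polynomial.C T.kap1))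
      (Polynomial.C Polynomial.X + Polynomial.C (Polynomial.C T.kap1)) T.alpha')
    (a := fun y z => ev2 (y + T.kap1) (z + T.kap1) T.alpha')
    (fun y z => by rw [evalEval_ev2]; simp [Polynomial.evalEval])
    (fun y z => h.skew _ _)
    (fun x y z => by
      have := h.j011 x (y + T.kap1) (z + T.kap1)
      rw [← add_assoc x y, ← add_assoc x z] at this
      linear_combination this + ev2 (y + T.kap1) (z + T.kap1) T.alpha' * hκ)
    ⟨y₀ - T.kap1, z₀ - T.kap1, by simpa using hne⟩ with
    ⟨h1, w, hw⟩ | ⟨h1, h2, w, hw⟩ | ⟨h1, h2, w, hw⟩ | ⟨h1, h2, w, hw⟩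
  · refine Or.inl ⟨⟨w, H2_ext fun x y => ?_⟩, h0, ⟨a, hη, ha1, ha2⟩, h1, hκ⟩
    rw [hback, hw]
    simp [ev2_d]
  · refine Or.inr (Or.inl ⟨⟨2 * w, H2_ext fun x y => ?_⟩, h0, hη0 ?_, h1, h2, hκ⟩)
    · rw [hback, hw, ev2_Z3]
      ring
    -- Here `λ₁ = 0`, so `aλ₁ = 0` says nothing about `a`. The cubic `y z (z - y)` vanishes when an
    -- argument is zero, so at the shifted points `1, 2, 0` only the term `-2wa` survives.
    · have := h.j111 (1 + T.kap1) (2 + T.kap1) (0 + T.kap1)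
      rw [hw, hw, hw, hη] at this
      simp only [ev2_smul_d_zero] at this
      have hw0 : w ≠ 0 := by
        rintro rfl
        rw [hback, hw] at hne
        simp at hne
      refine mul_left_cancel₀ hw0 ?_
      linear_combination (-1 / 2 : k) * this
  · refine Or.inr (Or.inr (Or.inl ⟨⟨2 * w, H2_ext fun x y => ?_⟩, h0, hη0 ?_, h1, h2, hκ⟩))
    · rw [hback, hw, ev2_Z4]
      ring
    · rw [h1] at ha1
      linear_combination 2 * ha1
  · refine Or.inr (Or.inr (Or.inr ⟨⟨6 * w, H2_ext fun x y => ?_⟩, h0, hη0 ?_, h1, h2, hκ⟩))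
    · rw [hback, hw, ev2_Z5]
      ring
    · rw [h1] at ha1
      linear_combination (3 / 2 : k) * ha1

end Classification

end SchrodingerVirasoro

end

theorem proposition4p1 {k : Type*} [Field k] [CharZero k]
    {L : Type*} [AddCommGroup L] [Module k[X] L] (e : Module.Basis (Fin 4) k[X] L)
    (m : ℕ) (T : SchrodingerVirasoro.Table k)
    (h11 : T.eta11 = 0) (h12 : T.eta12 = 0) (h21 : T.eta21 = 0) (h22 : T.eta22 = 0) :
    (∃ ρ : SchrodingerVirasoro.PseudoBracket k L,
        SchrodingerVirasoro.IsSchrodingerVirasoro e ρ m T) ↔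
      (m = 0 ∧ SchrodingerVirasoro.IsZ1 T) ∨ (m = 1 ∧ SchrodingerVirasoro.IsZ2 T) ∨
      (m = 2 ∧ SchrodingerVirasoro.IsZ3 T) ∨ (m = 2 ∧ SchrodingerVirasoro.IsZ4 T) ∨
      (m = 3 ∧ SchrodingerVirasoro.IsZ5 T) := by
  constructor
  · rintro ⟨ρ, hρ⟩
    have hc := hρ.isCompatible
    have hm := hρ.mType
    by_cases h0 : T.alpha' = 0
    -- For `α' = 0` only the conditions on `η` remain. In the other cases the explicit `α'` has a
    -- known type, and uniqueness of the type gives `m`.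
    · exact Or.inl ⟨hm.eq_zero_iff.1 h0, h0, hc.eta_eq⟩
    rcases hc.classification h0 with h | h | h | h
    · exact Or.inr (Or.inl ⟨hm.unique h.isMType h0, h⟩)
    · exact Or.inr (Or.inr (Or.inl ⟨hm.unique h.isMType h0, h⟩))
    · exact Or.inr (Or.inr (Or.inr (Or.inl ⟨hm.unique h.isMType h0, h⟩)))
    · exact Or.inr (Or.inr (Or.inr (Or.inr ⟨hm.unique h.isMType h0, h⟩)))
  · rintro (⟨rfl, h⟩ | ⟨rfl, h⟩ | ⟨rfl, h⟩ | ⟨rfl, h⟩ | ⟨rfl, h⟩)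
    · exact h.isCompatible.exists_bracket (Or.inl ⟨rfl, h.1⟩) h11 h12 h21 h22
    all_goals exact h.isCompatible.exists_bracket h.isMType h11 h12 h21 h22
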